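/- **Theorem Z (Three closure theorem).** Let $M^n$ ($n\ge 1$) be a smooth Riemannian manifold (without boundary, Hausdorff, second countable), with volume measure $dM$. *Simple triples.* A simple triple $(U,\Gamma,V)$ in $\mathbb R^n$ consists of an open set $U\subset\mathbb R^n$ diffeomorphic to an $n$-ball, an open subset $V$ of a hyperplane, diffeomorphic to an $(n-1)$-ball, and a set $\Gamma\subset\partial U$ that is the graph $\{x+u(x)\nu : x\in V\}$ of a function $u:V\to\mathbb R$ in the direction of the unit normal $\nu$ of the hyperplane. If $u$ is Lipschitz on $V$, it is called a Lipschitz simple domain. *Generalized Lipschitz domains.* An open set $D\subset M$ is a generalized Lipschitz domain if there are a compact smooth $n$-manifold $D'$ with (possibly empty) smooth boundary and a smooth map $\rho:D'\to M$ such that $\rho$ restricts to a diffeomorphism of $\operatorname{Int}D'$ onto $D$, at most finitely many points of $\partial D'$ are mapped to any given point of $M$, and there are finitely many sets $U'_i$ open in $D'$ with $\partial D'\subset\bigcup_i U'_i$ and sets $\Gamma'_i$ open in $\partial D'$ with $\bigcup_i\Gamma'_i=\partial D'$ such that, for every $i$, in a coordinate map of $D'$ the sets $U'_i\cap\operatorname{Int}D'$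 and $\Gamma'_i$ become the $U$ and $\Gamma$ of a simple triple, and in a coordinate map of $M$ the sets $\rho(U'_i\cap\operatorname{Int}D')$ and $\rho(\Gamma'_i)$ become the $U$ and $\Gamma$ of a Lipschitz simple domain. *Function spaces.* $W^{1,2}(D)$ is the space of $f\in L^2(D,dM)$ with a weak gradient $Df\in L^2$, with norm $(\int_D f^2+|Df|^2\,dM)^{1/2}$. For $m=0,1$ let $$\mathcal F_m(D)=\{f\in C^\infty(D)\cap C^m(\overline D): f|_{\partial D}=0\},\qquad \mathcal F_c(D)=\{f\in C^\infty(D):\overline{\operatorname{supp}f}\subset D\},$$ where $C^1(\overline D)$ means that $f$ and its gradient extend continuously to $\overline D$, and $$\mathcal G_0(D)=\Big\{f\in\mathcal F_0(D):\int_D f\,dM=0\Big\},\qquad \mathcal G_c(D)=\Big\{f\in\mathcal F_c(D):\int_D f\,dM=0\Big\}.$$ Let $E(D)$, $H(D)$ and $W^{1,2}_0(D)$ be the closures in $W^{1,2}(D)$ of $\mathcal F_0(D)\cap W^{1,2}(D)$, of $\mathcal G_0(D)\cap W^{1,2}(D)$ and of $\mathcal F_c(D)$, respectively. *Theorem.*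 Let $D$ be a generalized Lipschitz domain in $M$ with $\partial\overline D=\partial D$. Then $\mathcal F_1(D)$ and $\mathcal F_c(D)$ are contained in $W^{1,2}(D)$, and the closures in $W^{1,2}(D)$ of $\mathcal F_0(D)\cap W^{1,2}(D)$, $\mathcal F_1(D)$ and $\mathcal F_c(D)$ are the same space $E(D)$. In particular $E(D)=W^{1,2}_0(D)$. Moreover, $H(D)$ is the closure of $\mathcal G_c(D)$ in $W^{1,2}(D)$. -/

import Mathlib

open Set Filter Topology MeasureTheory Bundle
open scoped Manifold ContDiff ENNReal InnerProductSpace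

universe u v

noncomputable section

namespace ThreeClosure

/-! ### The Riemannian volume measure -/

/-- `M` is a countable disjoint union of Borel pieces, each contained in a compact subset of the
domain of a chart, and only finitely many of which meet a given compact set. -/
theorem exists_chart_partition (n : ℕ) (M : Type*) [TopologicalSpace M]
    [ChartedSpace (EuclideanSpace ℝ (Fin n)) M] [SecondCountableTopology M]
    [MeasurableSpace M] [BorelSpace M] :
    ∃ (s : Set M) (P : M → Set M), s.Countable ∧ (∀ p ∈ s, MeasurableSet (P p)) ∧
      s.PairwiseDisjoint P ∧ (⋃ p ∈ s, P p) = univ ∧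
      (∀ p ∈ s, ∃ C ⊆ (chartAt (EuclideanSpace ℝ (Fin n)) p).target, IsCompact C ∧
        P p ⊆ (chartAt (EuclideanSpace ℝ (Fin n)) p).symm '' C) ∧
      ∀ K : Set M, IsCompact K → {p ∈ s | (P p ∩ K).Nonempty}.Finite := by
  have hr : ∀ p : M, ∃ r > 0, Metric.closedBall (chartAt (EuclideanSpace ℝ (Fin n)) p p) r ⊆
      (chartAt (EuclideanSpace ℝ (Fin n)) p).target := fun p =>
    Metric.nhds_basis_closedBall.mem_iff.1
      ((chartAt (EuclideanSpace ℝ (Fin n)) p).open_target.mem_nhds (mem_chart_target _ p))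
  choose r hr0 hr using hr
  let B : M → Set M := fun p => (chartAt (EuclideanSpace ℝ (Fin n)) p).source ∩
    (chartAt (EuclideanSpace ℝ (Fin n)) p) ⁻¹'
      Metric.ball (chartAt (EuclideanSpace ℝ (Fin n)) p p) (r p)
  have hBo : ∀ p, IsOpen (B p) := fun p =>
    (chartAt (EuclideanSpace ℝ (Fin n)) p).isOpen_inter_preimage Metric.isOpen_ball
  have hBp : ∀ p, p ∈ B p := fun p => ⟨mem_chart_source _ p, Metric.mem_ball_self (hr0 p)⟩
  obtain ⟨s, hs, hcov⟩ :=
    TopologicalSpace.countable_cover_nhds fun p => (hBo p).mem_nhds (hBp p)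
  obtain ⟨f, hf⟩ := Set.countable_iff_exists_injOn.1 hs
  have hP : ∀ p, {q | q ∈ s ∧ f q < f p}.Countable := fun p => hs.mono fun q hq => hq.1
  refine ⟨s, fun p => B p \ ⋃ q ∈ {q | q ∈ s ∧ f q < f p}, B q, hs, ?_, ?_, ?_, ?_, ?_⟩
  · exact fun p _ => (hBo p).measurableSet.diff
      (MeasurableSet.biUnion (hP p) fun q _ => (hBo q).measurableSet)
  · intro p hp q hq hpq
    rw [Function.onFun, Set.disjoint_left]
    rintro z ⟨hz1, hz2⟩ ⟨hz3, hz4⟩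
    rcases lt_trichotomy (f p) (f q) with h | h | h
    · exact hz4 (mem_biUnion (x := p) ⟨hp, h⟩ hz1)
    · exact hpq (hf hp hq h)
    · exact hz2 (mem_biUnion (x := q) ⟨hq, h⟩ hz3)
  · refine eq_univ_of_forall fun z => ?_
    have hz : ∃ k, ∃ p ∈ s, f p = k ∧ z ∈ B p := by
      have : z ∈ ⋃ p ∈ s, B p := by rw [hcov]; trivial
      obtain ⟨p, hp, hzp⟩ := mem_iUnion₂.1 this
      exact ⟨f p, p, hp, rfl, hzp⟩
    classical
    obtain ⟨p, hp, hpk, hzp⟩ := Nat.find_spec hz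
    refine mem_biUnion hp ⟨hzp, fun hz' => ?_⟩
    obtain ⟨q, ⟨hq, hlt⟩, hzq⟩ := mem_iUnion₂.1 hz'
    exact Nat.find_min hz (hpk ▸ hlt) ⟨q, hq, rfl, hzq⟩
  · refine fun p _ => ⟨_, hr p, isCompact_closedBall _ _, ?_⟩
    rintro z ⟨⟨hz1, hz2⟩, -⟩
    exact ⟨_, Metric.ball_subset_closedBall hz2,
      (chartAt (EuclideanSpace ℝ (Fin n)) p).left_inv hz1⟩
  · intro K hK
    obtain ⟨t, ht, htf, hKt⟩ := hK.elim_finite_subcover_image (b := s) (c := B)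
      (fun p _ => hBo p) (by rw [hcov]; exact subset_univ _)
    obtain ⟨N, hN⟩ := (htf.image f).bddAbove
    refine Set.Finite.of_finite_image (f := f) ((Set.finite_Iic N).subset ?_)
      (hf.mono fun p hp => hp.1)
    rintro _ ⟨p, ⟨hp, z, ⟨hz1, hz2⟩, hzK⟩, rfl⟩
    obtain ⟨q, hq, hzq⟩ := mem_iUnion₂.1 (hKt hzK)
    refine le_trans (not_lt.1 fun hlt => hz2 ?_) (hN (mem_image_of_mem f hq))
    exact mem_biUnion (x := q) ⟨ht hq, hlt⟩ hzq

section Volume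

variable {n : ℕ} {M : Type*} [TopologicalSpace M]
  [ChartedSpace (EuclideanSpace ℝ (Fin n)) M]

/-- In the preferred chart at `p`, the coordinate vector field with constant coefficients `v`,
at the point of `M` with coordinates `y`. -/
def chartVector (p : M) (v y : EuclideanSpace ℝ (Fin n)) :
    TangentSpace (𝓡 n) ((chartAt (EuclideanSpace ℝ (Fin n)) p).symm y) :=
  mfderiv (𝓡 n) (𝓡 n) (chartAt (EuclideanSpace ℝ (Fin n)) p).symm y v

variable [RiemannianBundle (fun x : M => TangentSpace (𝓡 n) x)]

/-- The matrix `(g_{ij})` of the metric in the preferred chart at `p`. -/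
def chartGram (p : M) (y : EuclideanSpace ℝ (Fin n)) : Matrix (Fin n) (Fin n) ℝ :=
  Matrix.of fun i j => ⟪chartVector p (EuclideanSpace.single i 1) y,
    chartVector p (EuclideanSpace.single j 1) y⟫_ℝ

variable [MeasurableSpace M]

/-- The measure `√(det g_{ij}) dy` of the preferred chart at `p`, carried to `M`.  It lives on the
domain of that chart. -/
def chartVolume (p : M) : Measure M :=
  ((volume.restrict (chartAt (EuclideanSpace ℝ (Fin n)) p).target).withDensity
    (fun y => ENNReal.ofReal (√ (chartGram p y).det))).map
      (chartAt (EuclideanSpace ℝ (Fin n)) p).symm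

variable (n M) in
/-- The Riemannian volume measure of `M`, which is `√(det g_{ij}) dy` in every chart.  Since the
measures of two charts agree where both charts are defined, it is assembled from their restrictions
to the pieces of a countable Borel partition of `M` subordinate to the charts. -/
def riemannianVolume [SecondCountableTopology M] [BorelSpace M] : Measure M :=
  Measure.sum fun p : (exists_chart_partition n M).choose =>
    (chartVolume (n := n) (p : M)).restrict ((exists_chart_partition n M).choose_spec.choose p)

end Volume

/-! ### Weak gradients and the Sobolev space `W^{1,2}(D)` -/

/-- A locally integrable function times a smooth compactly supported one is integrable. -/
theorem integrable_mul_test {n : ℕ} {U : Set (EuclideanSpace ℝ (Fin n))}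
    {a ψ : EuclideanSpace ℝ (Fin n) → ℝ} (ha : LocallyIntegrableOn a U)
    (hψ : Continuous ψ) (hc : HasCompactSupport ψ) (hs : tsupport ψ ⊆ U) :
    Integrable fun y => a y * ψ y := by
  have h1 : IntegrableOn (fun y => a y * ψ y) (tsupport ψ) :=
    (ha.integrableOn_compact_subset hs hc).mul_continuousOn hψ.continuousOn hc
  refine (integrableOn_iff_integrable_of_support_subset fun y hy => ?_).1 h1
  exact subset_tsupport _ (right_ne_zero_of_mul hy)

section Sobolev

variable {n : ℕ} {M : Type*} [TopologicalSpace M]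
  [ChartedSpace (EuclideanSpace ℝ (Fin n)) M]

/-- The part of `D` in the domain of the preferred chart at `p`, seen in coordinates. -/
def chartDomain (D : TopologicalSpace.Opens M) (p : M) : Set (EuclideanSpace ℝ (Fin n)) :=
  (chartAt (EuclideanSpace ℝ (Fin n)) p).target ∩
    (chartAt (EuclideanSpace ℝ (Fin n)) p).symm ⁻¹' D

theorem isOpen_chartDomain (D : TopologicalSpace.Opens M) (p : M) :
    IsOpen (chartDomain (n := n) D p) :=
  (chartAt (EuclideanSpace ℝ (Fin n)) p).symm.isOpen_inter_preimage D.isOpen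

variable [RiemannianBundle (fun x : M => TangentSpace (𝓡 n) x)]

/-- The vector field `X` is a weak gradient of `f` on `D`: in the preferred chart at any point, the
function `f` and the components `⟪X, v⟫` of the covector field dual to `X` are locally integrable,
and `⟪X, v⟫` is the weak derivative of `f` in the coordinate direction `v`. -/
def IsWeakGradient (D : TopologicalSpace.Opens M) (f : M → ℝ)
    (X : ∀ x : M, TangentSpace (𝓡 n) x) : Prop :=
  ∀ p : M,
    LocallyIntegrableOn (fun y => f ((chartAt (EuclideanSpace ℝ (Fin n)) p).symm y))
      (chartDomain (n := n) D p) ∧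
    ∀ v : EuclideanSpace ℝ (Fin n),
      LocallyIntegrableOn (fun y =>
        ⟪X ((chartAt (EuclideanSpace ℝ (Fin n)) p).symm y), chartVector p v y⟫_ℝ)
        (chartDomain (n := n) D p) ∧
      ∀ ψ : EuclideanSpace ℝ (Fin n) → ℝ, ContDiff ℝ ∞ ψ → HasCompactSupport ψ →
        tsupport ψ ⊆ chartDomain (n := n) D p →
        ∫ y, f ((chartAt (EuclideanSpace ℝ (Fin n)) p).symm y) * fderiv ℝ ψ y v =
          - ∫ y, ⟪X ((chartAt (EuclideanSpace ℝ (Fin n)) p).symm y), chartVector p v y⟫_ℝ * ψ y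

theorem IsWeakGradient.zero (D : TopologicalSpace.Opens M) :
    IsWeakGradient (n := n) D (0 : M → ℝ) (fun _ => 0) := by
  intro p
  refine ⟨by simpa using (locallyIntegrableOn_zero), fun v => ⟨by simpa using locallyIntegrableOn_zero, fun ψ _ _ _ => by simp⟩⟩

theorem IsWeakGradient.add {D : TopologicalSpace.Opens M} {f g : M → ℝ}
    {X Y : ∀ x : M, TangentSpace (𝓡 n) x} (hf : IsWeakGradient D f X)
    (hg : IsWeakGradient D g Y) :
    IsWeakGradient D (f + g) (fun x => X x + Y x) := by
  intro p
  refine ⟨(hf p).1.add (hg p).1, fun v => ⟨?_, fun ψ h1 h2 h3 => ?_⟩⟩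
  · simp only [inner_add_left]
    exact ((hf p).2 v).1.add ((hg p).2 v).1
  · have hd : Continuous fun y => fderiv ℝ ψ y v :=
      (h1.continuous_fderiv (by simp)).clm_apply continuous_const
    have hdc : HasCompactSupport fun y => fderiv ℝ ψ y v := h2.fderiv_apply ℝ v
    have hds : tsupport (fun y => fderiv ℝ ψ y v) ⊆ chartDomain (n := n) D p :=
      (tsupport_fderiv_apply_subset ℝ v).trans h3
    simp only [inner_add_left, Pi.add_apply, add_mul]
    rw [integral_add (integrable_mul_test (hf p).1 hd hdc hds)
        (integrable_mul_test (hg p).1 hd hdc hds),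
      integral_add (integrable_mul_test ((hf p).2 v).1 h1.continuous h2 h3)
        (integrable_mul_test ((hg p).2 v).1 h1.continuous h2 h3),
      ((hf p).2 v).2 ψ h1 h2 h3, ((hg p).2 v).2 ψ h1 h2 h3]
    ring

theorem IsWeakGradient.smul {D : TopologicalSpace.Opens M} {f : M → ℝ}
    {X : ∀ x : M, TangentSpace (𝓡 n) x} (c : ℝ) (hf : IsWeakGradient D f X) :
    IsWeakGradient D (c • f) (fun x => c • X x) := by
  intro p
  refine ⟨(hf p).1.smul c, fun v => ⟨?_, fun ψ h1 h2 h3 => ?_⟩⟩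
  · simp only [real_inner_smul_left]
    exact ((hf p).2 v).1.smul c
  · simp only [real_inner_smul_left, Pi.smul_apply, smul_eq_mul, mul_assoc,
      integral_const_mul]
    rw [((hf p).2 v).2 ψ h1 h2 h3]
    ring

end Sobolev

/-- The norm squared of a vector, as a supremum over the images of a dense sequence. -/
theorem ofReal_sq_norm_eq_iSup {F G : Type*} [NormedAddCommGroup F] [InnerProductSpace ℝ F]
    [TopologicalSpace G] [TopologicalSpace.SeparableSpace G] [Nonempty G] (L : G → F)
    (hL : Continuous L) (hs : Function.Surjective L) (x : F) :
    ENNReal.ofReal (‖x‖ ^ 2) = ⨆ k : ℕ, ENNReal.ofReal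
      (2 * ⟪x, L (TopologicalSpace.denseSeq G k)⟫_ℝ -
        ⟪L (TopologicalSpace.denseSeq G k), L (TopologicalSpace.denseSeq G k)⟫_ℝ) := by
  have key : ∀ w : F, 2 * ⟪x, w⟫_ℝ - ⟪w, w⟫_ℝ = ‖x‖ ^ 2 - ‖x - w‖ ^ 2 := fun w => by
    rw [norm_sub_sq_real, real_inner_self_eq_norm_sq]; ring
  refine le_antisymm ?_ (iSup_le fun k => ENNReal.ofReal_le_ofReal ?_)
  · obtain ⟨v, hv⟩ := hs x
    have hc : Continuous fun w : G =>
        ENNReal.ofReal (2 * ⟪x, L w⟫_ℝ - ⟪L w, L w⟫_ℝ) :=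
      ENNReal.continuous_ofReal.comp (by fun_prop)
    have hcl : IsClosed {w : G | ENNReal.ofReal (2 * ⟪x, L w⟫_ℝ - ⟪L w, L w⟫_ℝ) ≤
        ⨆ k : ℕ, ENNReal.ofReal (2 * ⟪x, L (TopologicalSpace.denseSeq G k)⟫_ℝ -
        ⟪L (TopologicalSpace.denseSeq G k), L (TopologicalSpace.denseSeq G k)⟫_ℝ)} :=
      isClosed_le hc continuous_const
    have hv' := (TopologicalSpace.denseRange_denseSeq G).induction_on (p := fun w =>
      ENNReal.ofReal (2 * ⟪x, L w⟫_ℝ - ⟪L w, L w⟫_ℝ) ≤ _) v hcl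
      (fun k => le_iSup (fun k : ℕ => ENNReal.ofReal
        (2 * ⟪x, L (TopologicalSpace.denseSeq G k)⟫_ℝ -
        ⟪L (TopologicalSpace.denseSeq G k), L (TopologicalSpace.denseSeq G k)⟫_ℝ)) k)
    refine le_trans (le_of_eq ?_) hv'
    rw [hv, key]; simp
  · rw [key]; nlinarith [sq_nonneg ‖x - L (TopologicalSpace.denseSeq G k)‖]

section Measurability

variable {n : ℕ} {M : Type*} [TopologicalSpace M]
  [ChartedSpace (EuclideanSpace ℝ (Fin n)) M] [IsManifold (𝓡 n) ∞ M]

theorem chartVector_surjective (p : M) {y : EuclideanSpace ℝ (Fin n)}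
    (hy : y ∈ (chartAt (EuclideanSpace ℝ (Fin n)) p).target) :
    Function.Surjective fun v => chartVector p v y := by
  have : IsManifold (𝓡 n) 1 M := IsManifold.of_le (n := ∞) (by simp)
  exact (mdifferentiable_chart (I := 𝓡 n) p).symm.mfderiv_surjective hy

theorem continuous_chartVector (p : M) (v : EuclideanSpace ℝ (Fin n)) :
    ContinuousOn (fun y => (⟨_, chartVector p v y⟩ : TangentBundle (𝓡 n) M))
      (chartAt (EuclideanSpace ℝ (Fin n)) p).target := by
  have : IsManifold (𝓡 n) 1 M := IsManifold.of_le (n := ∞) (by simp)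
  have h := (contMDiffOn_chart_symm (I := 𝓡 n) (n := 1) (x := p)).continuousOn_tangentMapWithin
    le_rfl (chartAt (EuclideanSpace ℝ (Fin n)) p).open_target.uniqueMDiffOn
  have h2 : Continuous fun y : EuclideanSpace ℝ (Fin n) =>
      (⟨y, v⟩ : TangentBundle (𝓡 n) (EuclideanSpace ℝ (Fin n))) :=
    (tangentBundleModelSpaceHomeomorph (𝓡 n)).symm.continuous.comp
      (continuous_id.prodMk continuous_const)
  refine (h.comp h2.continuousOn fun y hy => hy).congr fun y hy => ?_
  simp only [Function.comp, tangentMapWithin, chartVector]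
  rw [mfderivWithin_of_isOpen (chartAt (EuclideanSpace ℝ (Fin n)) p).open_target hy]

variable [RiemannianBundle (fun x : M => TangentSpace (𝓡 n) x)]
  [IsContMDiffRiemannianBundle (𝓡 n) ∞ (EuclideanSpace ℝ (Fin n))
    (fun x : M => TangentSpace (𝓡 n) x)]

theorem continuousOn_chartVector_inner (p : M) (v : EuclideanSpace ℝ (Fin n)) :
    ContinuousOn (fun y => ⟪chartVector p v y, chartVector p v y⟫_ℝ)
      (chartAt (EuclideanSpace ℝ (Fin n)) p).target := by
  have : IsContinuousRiemannianBundle (EuclideanSpace ℝ (Fin n))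
      (fun x : M => TangentSpace (𝓡 n) x) := by
    obtain ⟨g, hg, h⟩ := IsContMDiffRiemannianBundle.exists_contMDiff (IB := 𝓡 n) (n := ∞)
      (F := EuclideanSpace ℝ (Fin n)) (E := fun x : M => TangentSpace (𝓡 n) x)
    exact ⟨g, hg.continuous, h⟩
  exact (continuous_chartVector p v).inner_bundle (continuous_chartVector p v)

/-- In a chart, the norm of a weak gradient is measurable. -/
theorem IsWeakGradient.aemeasurable_norm_chart {D : TopologicalSpace.Opens M} {f : M → ℝ}
    {X : ∀ x : M, TangentSpace (𝓡 n) x} (h : IsWeakGradient D f X) (p : M) :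
    AEMeasurable (fun y => ‖X ((chartAt (EuclideanSpace ℝ (Fin n)) p).symm y)‖)
      (volume.restrict (chartDomain (n := n) D p)) := by
  have hU := isOpen_chartDomain (n := n) D p
  have h1 : AEMeasurable (fun y => ⨆ k : ℕ, ENNReal.ofReal
      (2 * ⟪X ((chartAt (EuclideanSpace ℝ (Fin n)) p).symm y),
        chartVector p (TopologicalSpace.denseSeq _ k) y⟫_ℝ -
      ⟪chartVector p (TopologicalSpace.denseSeq _ k) y,
        chartVector p (TopologicalSpace.denseSeq _ k) y⟫_ℝ))
      (volume.restrict (chartDomain (n := n) D p)) := by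
    refine AEMeasurable.iSup fun k => AEMeasurable.ennreal_ofReal (AEMeasurable.sub ?_ ?_)
    · exact (((h p).2 _).1.aestronglyMeasurable.aemeasurable).const_mul 2
    · exact ((continuousOn_chartVector_inner p _).mono inter_subset_left).aemeasurable
        hU.measurableSet
  have h2 : AEMeasurable (fun y => √ (⨆ k : ℕ, ENNReal.ofReal
      (2 * ⟪X ((chartAt (EuclideanSpace ℝ (Fin n)) p).symm y),
        chartVector p (TopologicalSpace.denseSeq _ k) y⟫_ℝ -
      ⟪chartVector p (TopologicalSpace.denseSeq _ k) y,
        chartVector p (TopologicalSpace.denseSeq _ k) y⟫_ℝ)).toReal)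
      (volume.restrict (chartDomain (n := n) D p)) := h1.ennreal_toReal.sqrt
  refine h2.congr ((ae_restrict_iff' hU.measurableSet).2 (Eventually.of_forall fun y hy => ?_))
  have hLc : Continuous fun v : EuclideanSpace ℝ (Fin n) => chartVector p v y :=
    (mfderiv (𝓡 n) (𝓡 n) (chartAt (EuclideanSpace ℝ (Fin n)) p).symm y).continuous
  have := ofReal_sq_norm_eq_iSup (G := EuclideanSpace ℝ (Fin n)) (fun v => chartVector p v y) hLc
    (chartVector_surjective p hy.1) (X ((chartAt (EuclideanSpace ℝ (Fin n)) p).symm y))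
  beta_reduce
  rw [← this, ENNReal.toReal_ofReal (sq_nonneg _), Real.sqrt_sq (norm_nonneg _)]

variable [MeasurableSpace M] [SecondCountableTopology M] [BorelSpace M]

/-- The norm of a weak gradient is measurable for the Riemannian volume. -/
theorem IsWeakGradient.aemeasurable_norm {D : TopologicalSpace.Opens M} {f : M → ℝ}
    {X : ∀ x : M, TangentSpace (𝓡 n) x} (h : IsWeakGradient D f X) :
    AEMeasurable (fun x => ‖X x‖) ((riemannianVolume n M).restrict D) := by
  have hs : Countable (exists_chart_partition n M).choose :=
    (exists_chart_partition n M).choose_spec.choose_spec.1.to_subtype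
  rw [riemannianVolume, Measure.restrict_sum_of_countable, aemeasurable_sum_measure_iff]
  rintro ⟨p, hp⟩
  rw [Measure.restrict_comm D.isOpen.measurableSet]
  refine AEMeasurable.mono_measure ?_ Measure.restrict_le_self
  set e := chartAt (EuclideanSpace ℝ (Fin n)) p with he
  set μ := (volume.restrict e.target).withDensity
    (fun y => ENNReal.ofReal (√ (chartGram p y).det)) with hμ
  have hμt : μ ≪ volume.restrict e.target := withDensity_absolutelyContinuous _ _
  have hes : AEMeasurable e.symm μ :=
    (e.continuousOn_symm.aemeasurable e.open_target.measurableSet).mono_ac hμt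
  have hcv : chartVolume (n := n) p = μ.map e.symm := rfl
  set ν := μ.restrict (e.symm ⁻¹' D) with hν
  have hmap : (chartVolume (n := n) p).restrict D = ν.map e.symm := by
    rw [hcv, Measure.restrict_map_of_aemeasurable hes D.isOpen.measurableSet]
  have hνμ : ν ≤ μ := Measure.restrict_le_self
  have hesν : AEMeasurable e.symm ν := hes.mono_measure hνμ
  have hμm : ∀ᵐ y ∂μ, y ∈ e.target := hμt (ae_restrict_mem e.open_target.measurableSet)
  have hνm : ∀ᵐ y ∂ν, y ∈ e.target := hμm.filter_mono (ae_mono hνμ)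
  have hsm : ∀ᵐ x ∂(ν.map e.symm), x ∈ e.source :=
    (ae_map_iff hesν e.open_source.measurableSet).2 (hνm.mono fun y hy => e.map_target hy)
  have heν : AEMeasurable e (ν.map e.symm) := by
    have h1 := e.continuousOn.aemeasurable (μ := ν.map e.symm) e.open_source.measurableSet
    rwa [Measure.restrict_eq_self_of_ae_mem hsm] at h1
  have hνac : ν ≪ volume.restrict (chartDomain (n := n) D p) := by
    have h1 : NullMeasurableSet (e.symm ⁻¹' (D : Set M)) μ :=
      hes.nullMeasurableSet_preimage D.isOpen.measurableSet
    have h2 : NullMeasurableSet (e.symm ⁻¹' (D : Set M)) (volume.restrict e.target) :=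
      ((e.continuousOn_symm.aemeasurable e.open_target.measurableSet)
        ).nullMeasurableSet_preimage D.isOpen.measurableSet
    have h3 := hμt.restrict (e.symm ⁻¹' (D : Set M))
    rwa [Measure.restrict_restrict₀ h2, inter_comm] at h3
  have hg : AEMeasurable (fun y => ‖X (e.symm y)‖) ((ν.map e.symm).map e) := by
    have h1 : ν.map (e ∘ e.symm) = ν.map id :=
      Measure.map_congr (hνm.mono fun y hy => e.right_inv hy)
    rw [AEMeasurable.map_map_of_aemeasurable heν hesν, h1, Measure.map_id]
    exact (h.aemeasurable_norm_chart p).mono_ac hνac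
  rw [hmap]
  refine (hg.comp_aemeasurable heν).congr (hsm.mono fun x hx => ?_)
  simp only [Function.comp]
  rw [e.left_inv hx]

end Measurability

section SobolevSpace

variable {n : ℕ} {M : Type*} [TopologicalSpace M] [SecondCountableTopology M]
  [MeasurableSpace M] [BorelSpace M]
  [ChartedSpace (EuclideanSpace ℝ (Fin n)) M]
  [RiemannianBundle (fun x : M => TangentSpace (𝓡 n) x)]

variable (n) in
/-- `f` is square integrable on `D` and has a square integrable weak gradient on `D`. -/
def MemSobolev (D : TopologicalSpace.Opens M) (f : M → ℝ) : Prop :=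
  MemLp f 2 ((riemannianVolume n M).restrict D) ∧
    ∃ X : ∀ x : M, TangentSpace (𝓡 n) x, IsWeakGradient D f X ∧
      MemLp (fun x => ‖X x‖) 2 ((riemannianVolume n M).restrict D)

variable (n) in
/-- The `W^{1,2}(D)` norm `(∫_D f² + |X|²)^{1/2}` with values in `[0, ∞]`, where `X` is the weak
gradient of `f` on `D`.  (A weak gradient is unique up to a null set, so that the infimum is over
at most one value; it is `∞` if there is no weak gradient.) -/
def sobolevENorm (D : TopologicalSpace.Opens M) (f : M → ℝ) : ℝ≥0∞ :=
  ⨅ (X : ∀ x : M, TangentSpace (𝓡 n) x) (_ : IsWeakGradient D f X),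
    eLpNorm (fun x => √ (f x ^ 2 + ‖X x‖ ^ 2)) 2 ((riemannianVolume n M).restrict D)

theorem sobolevENorm_zero (D : TopologicalSpace.Opens M) :
    sobolevENorm n D (0 : M → ℝ) = 0 := by
  refine le_antisymm ((iInf₂_le _ (IsWeakGradient.zero (n := n) D)).trans ?_) zero_le
  simp

theorem sobolevENorm_smul_le {D : TopologicalSpace.Opens M} (c : ℝ) (f : M → ℝ) :
    sobolevENorm n D (c • f) ≤ ‖c‖ₑ * sobolevENorm n D f := by
  rcases eq_or_ne c 0 with rfl | hc
  · rw [zero_smul, sobolevENorm_zero]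
    exact zero_le
  have hc' : ‖c‖ₑ ≠ 0 := enorm_ne_zero.2 hc
  rw [sobolevENorm, sobolevENorm, ENNReal.mul_iInf_of_ne hc' enorm_ne_top]
  refine le_iInf fun X => ?_
  rw [ENNReal.mul_iInf_of_ne hc' enorm_ne_top]
  refine le_iInf fun hX => (iInf₂_le _ (hX.smul c)).trans ?_
  rw [← eLpNorm_const_smul]
  refine eLpNorm_mono fun x => le_of_eq ?_
  have h : (c * f x) ^ 2 + (|c| * ‖X x‖) ^ 2 = |c| ^ 2 * (f x ^ 2 + ‖X x‖ ^ 2) := by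
    rw [mul_pow, mul_pow, sq_abs]; ring
  rw [Pi.smul_apply, Pi.smul_apply, smul_eq_mul, smul_eq_mul, norm_smul, norm_mul,
    Real.norm_of_nonneg (Real.sqrt_nonneg _), Real.norm_of_nonneg (Real.sqrt_nonneg _),
    Real.norm_eq_abs, h, Real.sqrt_mul (sq_nonneg _), Real.sqrt_sq (abs_nonneg _)]

theorem sobolevENorm_lt_top {D : TopologicalSpace.Opens M} {f : M → ℝ}
    (hf : MemSobolev n D f) : sobolevENorm n D f < ⊤ := by
  obtain ⟨h1, X, hX, h2⟩ := hf
  refine (iInf₂_le _ hX).trans_lt ?_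
  refine ((h1.norm.add h2).mono' ?_ ?_).2
  · exact ((h1.1.aemeasurable.pow_const 2).add
      (h2.1.aemeasurable.pow_const 2)).sqrt.aestronglyMeasurable
  · refine Eventually.of_forall fun x => ?_
    rw [Real.norm_of_nonneg (Real.sqrt_nonneg _)]
    refine Real.sqrt_le_iff.2 ⟨add_nonneg (norm_nonneg _) (norm_nonneg _), ?_⟩
    have := mul_nonneg (norm_nonneg (f x)) (norm_nonneg (X x))
    have h3 : ‖f x‖ ^ 2 = f x ^ 2 := by simp
    simp only [Pi.add_apply]
    nlinarith

/-- The triangle inequality in the Euclidean sum of `ℝ` with an inner product space. -/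
theorem sqrt_sq_add_sq_add_le {F : Type*} [NormedAddCommGroup F] [InnerProductSpace ℝ F]
    (a b : ℝ) (x y : F) :
    √ ((a + b) ^ 2 + ‖x + y‖ ^ 2) ≤ √ (a ^ 2 + ‖x‖ ^ 2) + √ (b ^ 2 + ‖y‖ ^ 2) := by
  have h := norm_add_le (WithLp.toLp 2 (a, x) : WithLp 2 (ℝ × F)) (WithLp.toLp 2 (b, y))
  simpa [WithLp.prod_norm_eq_of_L2] using h

theorem MemSobolev.smul {D : TopologicalSpace.Opens M} {f : M → ℝ} (c : ℝ)
    (hf : MemSobolev n D f) : MemSobolev n D (c • f) := by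
  obtain ⟨hf1, X, hX, hf2⟩ := hf
  refine ⟨hf1.const_smul c, _, hX.smul c, ?_⟩
  simp only [norm_smul]
  exact hf2.const_mul _

variable [IsManifold (𝓡 n) ∞ M]
  [IsContMDiffRiemannianBundle (𝓡 n) ∞ (EuclideanSpace ℝ (Fin n))
    (fun x : M => TangentSpace (𝓡 n) x)]

theorem sobolevENorm_add_le {D : TopologicalSpace.Opens M} {f g : M → ℝ}
    (hf : MemSobolev n D f) (hg : MemSobolev n D g) :
    sobolevENorm n D (f + g) ≤ sobolevENorm n D f + sobolevENorm n D g := by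
  refine ENNReal.le_iInf₂_add_iInf₂ fun X hX Y hY => ?_
  refine (iInf₂_le _ (hX.add hY)).trans ?_
  have hm : ∀ (k : M → ℝ) (Z : ∀ x : M, TangentSpace (𝓡 n) x), MemSobolev n D k →
      IsWeakGradient D k Z → AEStronglyMeasurable (fun x => √ (k x ^ 2 + ‖Z x‖ ^ 2))
        ((riemannianVolume n M).restrict D) := fun k Z hk hZ =>
    ((hk.1.1.aemeasurable.pow_const 2).add
      (hZ.aemeasurable_norm.pow_const 2)).sqrt.aestronglyMeasurable
  refine le_trans (eLpNorm_mono_real fun x => ?_)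
    (eLpNorm_add_le (hm f X hf hX) (hm g Y hg hY) (by norm_num))
  rw [Real.norm_of_nonneg (Real.sqrt_nonneg _)]
  exact sqrt_sq_add_sq_add_le _ _ _ _

theorem MemSobolev.add {D : TopologicalSpace.Opens M} {f g : M → ℝ}
    (hf : MemSobolev n D f) (hg : MemSobolev n D g) : MemSobolev n D (f + g) := by
  obtain ⟨hf1, X, hX, hf2⟩ := hf
  obtain ⟨hg1, Y, hY, hg2⟩ := hg
  refine ⟨hf1.add hg1, _, hX.add hY, (hf2.add hg2).mono'
    (hX.add hY).aemeasurable_norm.aestronglyMeasurable (Eventually.of_forall fun x => ?_)⟩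
  rw [norm_norm]
  exact norm_add_le _ _

variable (n) in
/-- The functions in `W^{1,2}(D)`, before identifying functions that agree almost everywhere
on `D`.  They are functions on all of `M` whose values outside `D` are irrelevant. -/
def sobolevSubmodule (D : TopologicalSpace.Opens M) : Submodule ℝ (M → ℝ) where
  carrier := {f | MemSobolev n D f}
  zero_mem' := ⟨MemLp.zero, _, IsWeakGradient.zero D, by simp⟩
  add_mem' hf hg := hf.add hg
  smul_mem' c _ hf := hf.smul c

variable (n) in
/-- The functions in `W^{1,2}(D)` with the `W^{1,2}` seminorm. -/
def SobolevFun (D : TopologicalSpace.Opens M) : Type _ := sobolevSubmodule n D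

instance (D : TopologicalSpace.Opens M) : AddCommGroup (SobolevFun n D) :=
  inferInstanceAs (AddCommGroup (sobolevSubmodule n D))

instance (D : TopologicalSpace.Opens M) : Module ℝ (SobolevFun n D) :=
  inferInstanceAs (Module ℝ (sobolevSubmodule n D))

instance (D : TopologicalSpace.Opens M) : SeminormedAddCommGroup (SobolevFun n D) :=
  AddGroupSeminorm.toSeminormedAddCommGroup
    { toFun := fun f => (sobolevENorm n D f.1).toReal
      map_zero' := by
        change (sobolevENorm n D (0 : M → ℝ)).toReal = 0
        rw [sobolevENorm_zero, ENNReal.toReal_zero]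
      add_le' := fun f g => by
        rw [← ENNReal.toReal_add (sobolevENorm_lt_top f.2).ne (sobolevENorm_lt_top g.2).ne]
        exact ENNReal.toReal_mono (ENNReal.add_ne_top.2
          ⟨(sobolevENorm_lt_top f.2).ne, (sobolevENorm_lt_top g.2).ne⟩)
          (sobolevENorm_add_le f.2 g.2)
      neg' := fun f => by
        have h : ∀ k : M → ℝ, sobolevENorm n D (-k) ≤ sobolevENorm n D k := fun k => by
          simpa using sobolevENorm_smul_le (n := n) (D := D) (-1) k
        change (sobolevENorm n D (-f.1)).toReal = (sobolevENorm n D f.1).toReal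
        exact congrArg _ (le_antisymm (h _) (by simpa using h (-f.1))) }

theorem SobolevFun.norm_def {D : TopologicalSpace.Opens M} (f : SobolevFun n D) :
    ‖f‖ = (sobolevENorm n D f.1).toReal := rfl

instance (D : TopologicalSpace.Opens M) : NormedSpace ℝ (SobolevFun n D) where
  norm_smul_le c f := by
    rw [SobolevFun.norm_def, SobolevFun.norm_def, ← toReal_enorm, ← ENNReal.toReal_mul]
    exact ENNReal.toReal_mono (ENNReal.mul_ne_top enorm_ne_top (sobolevENorm_lt_top f.2).ne)
      (sobolevENorm_smul_le c f.1)

variable (n) in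
/-- The normed space `W^{1,2}(D)`: functions at `W^{1,2}`-distance zero, that is, functions that
agree almost everywhere on `D`, are identified. -/
abbrev SobolevSpace (D : TopologicalSpace.Opens M) : Type _ := SeparationQuotient (SobolevFun n D)

/-- The intersection with `W^{1,2}(D)` of a class `S` of functions. -/
def inSobolev (D : TopologicalSpace.Opens M) (S : Set (M → ℝ)) : Set (SobolevSpace n D) :=
  SeparationQuotient.mk '' {f : SobolevFun n D | f.1 ∈ S}

end SobolevSpace

/-! ### The classes of functions and their closures -/

section Classes

variable {n : ℕ} {M : Type*} [TopologicalSpace M] [SecondCountableTopology M]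
  [MeasurableSpace M] [BorelSpace M]
  [ChartedSpace (EuclideanSpace ℝ (Fin n)) M]

variable (n) in
/-- `F_0(D)`: functions in `C^∞(D) ∩ C^0(D̄)` that vanish on `∂D`. -/
def classF0 (D : TopologicalSpace.Opens M) : Set (M → ℝ) :=
  {f | ContMDiffOn (𝓡 n) 𝓘(ℝ, ℝ) ∞ f D ∧ ContinuousOn f (closure D) ∧
    ∀ x ∈ frontier (D : Set M), f x = 0}

variable (n) in
/-- `F_c(D)`: functions in `C^∞(D)` the closure (in `M`) of whose support is contained in `D`;
they are extended to `M` by zero. -/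
def classFc (D : TopologicalSpace.Opens M) : Set (M → ℝ) :=
  {f | ContMDiffOn (𝓡 n) 𝓘(ℝ, ℝ) ∞ f D ∧ tsupport f ⊆ D}

variable [RiemannianBundle (fun x : M => TangentSpace (𝓡 n) x)] [IsManifold (𝓡 n) ∞ M]

variable (n) in
/-- `F_1(D)`: functions in `C^∞(D) ∩ C^1(D̄)` that vanish on `∂D`, where `C^1(D̄)` means that the
function and its gradient have continuous extensions to `D̄`. -/
def classF1 (D : TopologicalSpace.Opens M) : Set (M → ℝ) :=
  {f | f ∈ classF0 n D ∧ ∃ X : ∀ x : M, TangentSpace (𝓡 n) x,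
    ContinuousOn (fun x => (⟨x, X x⟩ : TangentBundle (𝓡 n) M)) (closure D) ∧
    ∀ x ∈ D, ∀ v : TangentSpace (𝓡 n) x, mfderiv (𝓡 n) 𝓘(ℝ, ℝ) f x v = ⟪X x, v⟫_ℝ}

variable (n) in
/-- `G_0(D)`: the functions in `F_0(D)` with mean zero. -/
def classG0 (D : TopologicalSpace.Opens M) : Set (M → ℝ) :=
  {f | f ∈ classF0 n D ∧ ∫ x in (D : Set M), f x ∂(riemannianVolume n M) = 0}

variable (n) in
/-- `G_c(D)`: the functions in `F_c(D)` with mean zero. -/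
def classGc (D : TopologicalSpace.Opens M) : Set (M → ℝ) :=
  {f | f ∈ classFc n D ∧ ∫ x in (D : Set M), f x ∂(riemannianVolume n M) = 0}

variable [IsContMDiffRiemannianBundle (𝓡 n) ∞ (EuclideanSpace ℝ (Fin n))
  (fun x : M => TangentSpace (𝓡 n) x)]

variable (n) in
/-- `E(D)`: the closure of `F_0(D) ∩ W^{1,2}(D)` in `W^{1,2}(D)`. -/
def spaceE (D : TopologicalSpace.Opens M) : Set (SobolevSpace n D) :=
  closure (inSobolev D (classF0 n D))

variable (n) in
/-- `H(D)`: the closure of `G_0(D) ∩ W^{1,2}(D)` in `W^{1,2}(D)`. -/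
def spaceH (D : TopologicalSpace.Opens M) : Set (SobolevSpace n D) :=
  closure (inSobolev D (classG0 n D))

variable (n) in
/-- `W_0^{1,2}(D)`: the closure of `F_c(D)` in `W^{1,2}(D)`. -/
def spaceW0 (D : TopologicalSpace.Opens M) : Set (SobolevSpace n D) :=
  closure (inSobolev D (classFc n D))

end Classes

/-! ### Generalized Lipschitz domains -/

/-- The set `S` is open and diffeomorphic to the open unit ball of the ambient space. -/
def IsDiffeomorphicToBall {F : Type*} [NormedAddCommGroup F] [NormedSpace ℝ F] (S : Set F) : Prop :=
  ∃ e : OpenPartialHomeomorph F F, e.source = S ∧ e.target = Metric.ball 0 1 ∧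
    ContDiffOn ℝ ∞ e e.source ∧ ContDiffOn ℝ ∞ e.symm e.target

/-- `(U, Γ, V)` is a simple triple: `U` and `V` are diffeomorphic to balls of `ℝⁿ` and of the
hyperplane `ν^⊥`, and `Γ ⊆ ∂U` is the graph over `V`, in the direction of the unit normal `ν`, of
the function `u`. -/
structure IsSimpleTriple {n : ℕ} (U Γ : Set (EuclideanSpace ℝ (Fin n)))
    (ν : EuclideanSpace ℝ (Fin n)) (V : Set ↥(ℝ ∙ ν)ᗮ) (u : ↥(ℝ ∙ ν)ᗮ → ℝ) : Prop where
  norm_eq : ‖ν‖ = 1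
  domain : IsDiffeomorphicToBall U
  base : IsDiffeomorphicToBall V
  graph : Γ = (fun x : ↥(ℝ ∙ ν)ᗮ => (x : EuclideanSpace ℝ (Fin n)) + u x • ν) '' V
  subset_frontier : Γ ⊆ frontier U

/-- `(U, Γ)` underlies a simple triple `(U, Γ, V)`. -/
def IsSimple {n : ℕ} (U Γ : Set (EuclideanSpace ℝ (Fin n))) : Prop :=
  ∃ (ν : EuclideanSpace ℝ (Fin n)) (V : Set ↥(ℝ ∙ ν)ᗮ) (u : ↥(ℝ ∙ ν)ᗮ → ℝ),
    IsSimpleTriple U Γ ν V u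

/-- `(U, Γ)` underlies a Lipschitz simple domain `(U, Γ, V)`. -/
def IsLipschitzSimple {n : ℕ} (U Γ : Set (EuclideanSpace ℝ (Fin n))) : Prop :=
  ∃ (ν : EuclideanSpace ℝ (Fin n)) (V : Set ↥(ℝ ∙ ν)ᗮ) (u : ↥(ℝ ∙ ν)ᗮ → ℝ),
    IsSimpleTriple U Γ ν V u ∧ ∃ K, LipschitzOnWith K u V

section Lipschitz

variable {n : ℕ} [NeZero n] {M : Type*} [TopologicalSpace M]
  [ChartedSpace (EuclideanSpace ℝ (Fin n)) M]
  {D' : Type*} [TopologicalSpace D'] [ChartedSpace (EuclideanHalfSpace n) D']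

variable (n) in
/-- `ρ : D' → M` is a boundary gluing map: it is smooth, restricts to a diffeomorphism of the
interior of `D'` onto its image, and maps at most finitely many points of `∂D'` to any given
point. -/
structure IsBoundaryGluingMap (ρ : D' → M) : Prop where
  smooth : ContMDiff (𝓡∂ n) (𝓡 n) ∞ ρ
  injOn : InjOn ρ ((𝓡∂ n).interior D')
  localDiffeo : IsLocalDiffeomorphOn (𝓡∂ n) (𝓡 n) ∞ ρ ((𝓡∂ n).interior D')
  finite : ∀ p : M, ((𝓡∂ n).boundary D' ∩ ρ ⁻¹' {p}).Finite

variable (n) in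
/-- The finite family `(U' i, Γ' i)` covers `∂D'` by simple triples, each of which lies in `ℝⁿ`
through a coordinate map of `D'`.  The `U' i` are open in `D'`; the open subset of `ℝⁿ` in the
triple is the image of the part of `U' i` in the interior of `D'`. -/
structure IsSimpleCover {m : ℕ} (U' Γ' : Fin m → Set D') : Prop where
  isOpen : ∀ i, IsOpen (U' i)
  boundary_subset : (𝓡∂ n).boundary D' ⊆ ⋃ i, U' i
  isOpen_boundary : ∀ i, ∃ O : Set D', IsOpen O ∧ Γ' i = O ∩ (𝓡∂ n).boundary D'
  iUnion_eq : ⋃ i, Γ' i = (𝓡∂ n).boundary D'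
  simple : ∀ i, ∃ φ ∈ IsManifold.maximalAtlas (𝓡∂ n) ∞ D', U' i ∪ Γ' i ⊆ φ.source ∧
    IsSimple (φ.extend (𝓡∂ n) '' (U' i ∩ (𝓡∂ n).interior D')) (φ.extend (𝓡∂ n) '' Γ' i)

end Lipschitz

/-- `D` is a generalized Lipschitz domain of `M`: it is the image of the interior of a compact
smooth manifold with boundary `D'` under a boundary gluing map `ρ`, and `∂D'` is covered by a finite
family of simple triples whose images under `ρ` are Lipschitz simple domains through coordinate maps
of `M`. -/
def IsGeneralizedLipschitzDomain (n : ℕ) [NeZero n] {M : Type u} [TopologicalSpace M]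
    [ChartedSpace (EuclideanSpace ℝ (Fin n)) M] (D : TopologicalSpace.Opens M) : Prop :=
  ∃ (D' : Type v) (_ : TopologicalSpace D') (_ : ChartedSpace (EuclideanHalfSpace n) D'),
    IsManifold (𝓡∂ n) ∞ D' ∧ T2Space D' ∧ CompactSpace D' ∧
    ∃ ρ : D' → M, IsBoundaryGluingMap n ρ ∧ ρ '' ((𝓡∂ n).interior D') = D ∧
      ∃ (m : ℕ) (U' Γ' : Fin m → Set D'), IsSimpleCover n U' Γ' ∧
        ∀ i, ∃ ψ ∈ IsManifold.maximalAtlas (𝓡 n) ∞ M,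
          ρ '' (U' i ∩ (𝓡∂ n).interior D') ∪ ρ '' Γ' i ⊆ ψ.source ∧
          IsLipschitzSimple (ψ '' (ρ '' (U' i ∩ (𝓡∂ n).interior D'))) (ψ '' (ρ '' Γ' i))

end ThreeClosure

end

/-! The point is that cutting off small values turns a function vanishing on `∂D` into one supported
inside `D`, at little cost in `W^{1,2}`. Let `f ∈ F_0(D) ∩ W^{1,2}(D)`, and let `θ_k` be smooth
functions on the line (`exists_truncation`) that are the identity near `0`, have uniformly bounded
derivatives, satisfy `|θ_k t| ≤ |t|`, and vanish together with their derivatives at each `t ≠ 0`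
once `k` is large. Then `g_k = f - θ_k ∘ f` vanishes where `|f|` is small. Since `f` is continuous
on `D̄` and zero on `∂D`, the closed support of `g_k` lies in `D`, so `g_k ∈ F_c(D)`.

The error `θ_k ∘ f` has gradient `θ_k'(f) Df`. At points with `f ≠ 0` both are eventually zero. On
`{f = 0}` the function is zero, and `Df = 0` almost everywhere (`IsGradientOn.ae_eq_zero`, from a
density-point argument in charts). As `|f| + C |Df|` is a square integrable bound, dominated
convergence gives `g_k → f` in `W^{1,2}`, and likewise convergence of the integrals
(`exists_tendsto_classFc`).

For mean zero functions, the means of the `g_k` tend to `0`. Subtracting small multiples of a fixed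
`h ∈ F_c(D)` with nonzero mean puts them in `G_c(D)`; if there is no such `h`, then `F_c(D) =
G_c(D)` already (`exists_tendsto_classGc`).

The closure `D̄` is compact, being contained in the image of the compact `D'` under `ρ`, so `D` has
finite volume. This gives `F_1(D) ⊆ W^{1,2}(D)`, and the inclusions `F_c ⊆ F_1 ⊆ F_0` then force the
three closures to agree. The remaining lemmas relate the classical gradient to the weak one, which
is unique almost everywhere, and transfer statements between `M` and its charts. -/

noncomputable section

namespace ThreeClosure

/-! ### Continuity of the metric in charts -/

section ContinuousMetric

variable {n : ℕ} {M : Type*} [TopologicalSpace M]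
  [ChartedSpace (EuclideanSpace ℝ (Fin n)) M] [IsManifold (𝓡 n) ∞ M]
  [RiemannianBundle (fun x : M => TangentSpace (𝓡 n) x)]
  [IsContMDiffRiemannianBundle (𝓡 n) ∞ (EuclideanSpace ℝ (Fin n))
    (fun x : M => TangentSpace (𝓡 n) x)]

theorem isContinuousRiemannianBundle_tangentSpace :
    IsContinuousRiemannianBundle (EuclideanSpace ℝ (Fin n))
      (fun x : M => TangentSpace (𝓡 n) x) := by
  obtain ⟨g, hg, h⟩ := IsContMDiffRiemannianBundle.exists_contMDiff (IB := 𝓡 n) (n := ∞)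
    (F := EuclideanSpace ℝ (Fin n)) (E := fun x : M => TangentSpace (𝓡 n) x)
  exact ⟨g, hg.continuous, h⟩

theorem continuousOn_chartGram (p : M) :
    ContinuousOn (fun y => chartGram (n := n) p y)
      (chartAt (EuclideanSpace ℝ (Fin n)) p).target := by
  have := isContinuousRiemannianBundle_tangentSpace (n := n) (M := M)
  refine continuousOn_pi.2 fun i => continuousOn_pi.2 fun j => ?_
  exact (continuous_chartVector p _).inner_bundle (continuous_chartVector p _)

end ContinuousMetric

/-! ### Null sets and compact sets for the Riemannian volume -/

section VolumeLemmas

variable {n : ℕ} {M : Type*} [TopologicalSpace M] [SecondCountableTopology M]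
  [MeasurableSpace M] [BorelSpace M]
  [ChartedSpace (EuclideanSpace ℝ (Fin n)) M]
  [RiemannianBundle (fun x : M => TangentSpace (𝓡 n) x)]

/-- A property that holds almost everywhere in every chart holds almost everywhere. -/
theorem ae_restrict_riemannianVolume {D : TopologicalSpace.Opens M} {P : M → Prop}
    (h : ∀ p : M, ∀ᵐ y ∂(volume.restrict (chartDomain (n := n) D p)),
      P ((chartAt (EuclideanSpace ℝ (Fin n)) p).symm y)) :
    ∀ᵐ x ∂((riemannianVolume n M).restrict D), P x := by
  have hs : Countable (exists_chart_partition n M).choose :=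
    (exists_chart_partition n M).choose_spec.choose_spec.1.to_subtype
  rw [riemannianVolume, Measure.restrict_sum_of_countable, Measure.ae_sum_iff]
  rintro ⟨p, hp⟩
  rw [Measure.restrict_comm D.isOpen.measurableSet]
  -- The restriction to the piece of the partition can be dropped: the property holds almost
  -- everywhere for the whole chart measure on `D`.
  refine Measure.restrict_le_self.absolutelyContinuous.ae_le ?_
  change ∀ᵐ x ∂((chartVolume (n := n) p).restrict D), P x
  set e := chartAt (EuclideanSpace ℝ (Fin n)) p with he
  set μ := (volume.restrict e.target).withDensity
    (fun y => ENNReal.ofReal (√ (chartGram p y).det)) with hμ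
  have hμt : μ ≪ volume.restrict e.target := withDensity_absolutelyContinuous _ _
  have hes : AEMeasurable e.symm μ :=
    (e.continuousOn_symm.aemeasurable e.open_target.measurableSet).mono_ac hμt
  have hcv : chartVolume (n := n) p = μ.map e.symm := rfl
  set ν := μ.restrict (e.symm ⁻¹' D) with hν
  have hmap : (chartVolume (n := n) p).restrict D = ν.map e.symm := by
    rw [hcv, Measure.restrict_map_of_aemeasurable hes D.isOpen.measurableSet]
  have hνμ : ν ≤ μ := Measure.restrict_le_self
  have hesν : AEMeasurable e.symm ν := hes.mono_measure hνμ
  have hμm : ∀ᵐ y ∂μ, y ∈ e.target := hμt (ae_restrict_mem e.open_target.measurableSet)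
  have hνm : ∀ᵐ y ∂ν, y ∈ e.target := hμm.filter_mono (ae_mono hνμ)
  have hsm : ∀ᵐ x ∂(ν.map e.symm), x ∈ e.source :=
    (ae_map_iff hesν e.open_source.measurableSet).2 (hνm.mono fun y hy => e.map_target hy)
  have heν : AEMeasurable e (ν.map e.symm) := by
    have h1 := e.continuousOn.aemeasurable (μ := ν.map e.symm) e.open_source.measurableSet
    rwa [Measure.restrict_eq_self_of_ae_mem hsm] at h1
  have hνac : ν ≪ volume.restrict (chartDomain (n := n) D p) := by
    have h2 : NullMeasurableSet (e.symm ⁻¹' (D : Set M)) (volume.restrict e.target) :=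
      ((e.continuousOn_symm.aemeasurable e.open_target.measurableSet)
        ).nullMeasurableSet_preimage D.isOpen.measurableSet
    have h3 := hμt.restrict (e.symm ⁻¹' (D : Set M))
    rwa [Measure.restrict_restrict₀ h2, inter_comm] at h3
  -- `P` is not assumed measurable, so the statement is not carried through `e.symm` by
  -- `ae_map_iff`. The measure is pushed back by `e` instead, and `ae_of_ae_map` requires no
  -- measurability of `P`.
  have hg : ∀ᵐ y ∂((ν.map e.symm).map e), P (e.symm y) := by
    have h1 : ν.map (e ∘ e.symm) = ν.map id :=
      Measure.map_congr (hνm.mono fun y hy => e.right_inv hy)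
    rw [AEMeasurable.map_map_of_aemeasurable heν hesν, h1, Measure.map_id]
    exact hνac.ae_le (h p)
  rw [hmap]
  filter_upwards [ae_of_ae_map heν hg, hsm] with x hx hxs
  rwa [e.left_inv hxs] at hx

variable [IsManifold (𝓡 n) ∞ M]
  [IsContMDiffRiemannianBundle (𝓡 n) ∞ (EuclideanSpace ℝ (Fin n))
    (fun x : M => TangentSpace (𝓡 n) x)]

/-- The Riemannian volume is finite on compact sets. -/
theorem riemannianVolume_lt_top [T2Space M] {K : Set M} (hK : IsCompact K) :
    riemannianVolume n M K < ⊤ := by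
  obtain ⟨hs, hm, -, -, hC, hfin⟩ := (exists_chart_partition n M).choose_spec.choose_spec
  set s := (exists_chart_partition n M).choose
  set P := (exists_chart_partition n M).choose_spec.choose
  have hdef : riemannianVolume n M = Measure.sum fun p : s =>
    (chartVolume (n := n) (p : M)).restrict (P p) := rfl
  -- Each piece lies over a compact subset of the chart's target, where the continuous density
  -- `√(det g_{ij})` is bounded.
  have hpiece : ∀ p ∈ s, chartVolume (n := n) p (P p) < ⊤ := by
    intro p hp
    obtain ⟨C, hCt, hCc, hPC⟩ := hC p hp
    set e := chartAt (EuclideanSpace ℝ (Fin n)) p with he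
    refine (measure_mono hPC).trans_lt ?_
    have hCm : MeasurableSet (e.symm '' C) :=
      (hCc.image_of_continuousOn (e.continuousOn_symm.mono hCt)).measurableSet
    have hem : AEMeasurable e.symm ((volume.restrict e.target).withDensity
        (fun y => ENNReal.ofReal (√ (chartGram p y).det))) :=
      (e.continuousOn_symm.aemeasurable e.open_target.measurableSet).mono_ac
        (withDensity_absolutelyContinuous _ _)
    rw [chartVolume, Measure.map_apply_of_aemeasurable hem hCm, withDensity_apply',
      Measure.restrict_restrict₀' e.open_target.measurableSet.nullMeasurableSet]
    -- Outside `e.target` the map `e.symm` has arbitrary values, so the preimage is `C` only after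
    -- intersection with the target.
    have hset : e.symm ⁻¹' (e.symm '' C) ∩ e.target = C := by
      ext y
      refine ⟨?_, fun hy => ⟨mem_image_of_mem _ hy, hCt hy⟩⟩
      rintro ⟨⟨z, hz, hzy⟩, hy⟩
      rwa [← e.symm.injOn (hCt hz) hy hzy]
    rw [hset]
    have hcont : ContinuousOn (fun y => √ (chartGram (n := n) p y).det) C :=
      (Continuous.matrix_det continuous_id).comp_continuousOn
        ((continuousOn_chartGram p).mono hCt) |>.sqrt
    obtain ⟨B, hB⟩ := (hCc.bddAbove_image hcont)
    calc ∫⁻ y in C, ENNReal.ofReal (√ (chartGram p y).det)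
        ≤ ∫⁻ _ in C, ENNReal.ofReal B := setLIntegral_mono' hCc.measurableSet fun y hy =>
          ENNReal.ofReal_le_ofReal (hB (mem_image_of_mem _ hy))
      _ < ⊤ := by
        rw [setLIntegral_const]
        exact ENNReal.mul_lt_top ENNReal.ofReal_lt_top hCc.measure_lt_top
  rw [hdef, Measure.sum_apply _ hK.measurableSet]
  -- Local finiteness of the partition leaves a finite sum of finite terms.
  have hF : {p : s | (P p ∩ K).Nonempty}.Finite :=
    (hfin K hK).preimage_embedding (Function.Embedding.subtype _) |>.subset
      fun p hp => ⟨p.2, hp⟩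
  rw [tsum_eq_sum (s := hF.toFinset)]
  · refine ENNReal.sum_lt_top.2 fun p _ => ?_
    rw [Measure.restrict_apply hK.measurableSet]
    exact (measure_mono inter_subset_right).trans_lt (hpiece p p.2)
  · intro p hp
    rw [Measure.restrict_apply hK.measurableSet, inter_comm]
    have : ¬ (P p ∩ K).Nonempty := by simpa using hp
    rw [not_nonempty_iff_eq_empty.1 this, measure_empty]

end VolumeLemmas

/-! ### Coordinate fields and the Gram matrix -/

section Chart

variable {n : ℕ} {M : Type*} [TopologicalSpace M]
  [ChartedSpace (EuclideanSpace ℝ (Fin n)) M]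

/-- Linearity of the differential of the inverse chart. It reduces metric quantities, and tests
against all coordinate directions, to the `n` basis fields. -/
theorem chartVector_eq_sum (p : M) (a y : EuclideanSpace ℝ (Fin n)) :
    chartVector p a y = ∑ i, a i • chartVector p (EuclideanSpace.single i 1) y := by
  have ha : a = ∑ i, a i • EuclideanSpace.single i (1 : ℝ) := by
    ext j; simp [Finset.sum_apply, Pi.single_apply]
  let L := mfderiv (𝓡 n) (𝓡 n) (chartAt (EuclideanSpace ℝ (Fin n)) p).symm y
  change L a = ∑ i, a i • L (EuclideanSpace.single i 1)
  conv_lhs => rw [ha]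
  exact (map_sum L _ _).trans (Finset.sum_congr rfl fun i _ => map_smul L _ _)

/-- The metric in the preferred chart at `p` is given by the Gram matrix. -/
theorem inner_chartVector [RiemannianBundle (fun x : M => TangentSpace (𝓡 n) x)]
    (p : M) (a b y : EuclideanSpace ℝ (Fin n)) :
    ⟪chartVector p a y, chartVector p b y⟫_ℝ =
      ∑ i, b i * ((chartGram p y).mulVec a) i := by
  rw [chartVector_eq_sum p a, chartVector_eq_sum p b, inner_sum]
  refine Finset.sum_congr rfl fun i _ => ?_
  rw [real_inner_smul_right, sum_inner, Matrix.mulVec, dotProduct]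
  congr 1
  refine Finset.sum_congr rfl fun j _ => ?_
  rw [real_inner_smul_left, mul_comm, real_inner_comm]
  rfl

variable [IsManifold (𝓡 n) ∞ M]

theorem contDiffOn_comp_chart_symm {D : TopologicalSpace.Opens M}
    {f : M → ℝ} (hf : ContMDiffOn (𝓡 n) 𝓘(ℝ, ℝ) ∞ f D) (p : M) :
    ContDiffOn ℝ ∞ (fun y => f ((chartAt (EuclideanSpace ℝ (Fin n)) p).symm y))
      (chartDomain (n := n) D p) :=
  contMDiffOn_iff_contDiffOn.1 (hf.comp
    ((contMDiffOn_chart_symm (I := 𝓡 n) (n := ∞) (x := p)).mono inter_subset_left)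
    fun _ hy => hy.2)

/-- Continuity of the tangent map of the inverse chart. The coefficients may vary because the
gradient will be written in this form. -/
theorem continuousOn_chartVector_comp (p : M) {w : EuclideanSpace ℝ (Fin n) → EuclideanSpace ℝ (Fin n)}
    {S : Set (EuclideanSpace ℝ (Fin n))} (hw : ContinuousOn w S)
    (hS : S ⊆ (chartAt (EuclideanSpace ℝ (Fin n)) p).target) :
    ContinuousOn (fun y => (⟨_, chartVector p (w y) y⟩ : TangentBundle (𝓡 n) M)) S := by
  have : IsManifold (𝓡 n) 1 M := IsManifold.of_le (n := ∞) (by simp)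
  have h := (contMDiffOn_chart_symm (I := 𝓡 n) (n := 1) (x := p)).continuousOn_tangentMapWithin
    le_rfl (chartAt (EuclideanSpace ℝ (Fin n)) p).open_target.uniqueMDiffOn
  have h2 : ContinuousOn (fun y : EuclideanSpace ℝ (Fin n) =>
      (⟨y, w y⟩ : TangentBundle (𝓡 n) (EuclideanSpace ℝ (Fin n)))) S :=
    (tangentBundleModelSpaceHomeomorph (𝓡 n)).symm.continuous.comp_continuousOn
      (continuousOn_id.prodMk hw)
  refine (h.comp h2 fun y hy => hS hy).congr fun y hy => ?_
  simp only [Function.comp, tangentMapWithin, chartVector]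
  rw [mfderivWithin_of_isOpen (chartAt (EuclideanSpace ℝ (Fin n)) p).open_target (hS hy)]

theorem chartVector_injective (p : M) {y : EuclideanSpace ℝ (Fin n)}
    (hy : y ∈ (chartAt (EuclideanSpace ℝ (Fin n)) p).target) :
    Function.Injective fun v => chartVector p v y := by
  have : IsManifold (𝓡 n) 1 M := IsManifold.of_le (n := ∞) (by simp)
  exact (mdifferentiable_chart (I := 𝓡 n) p).symm.mfderiv_injective hy

/-- A null vector of the Gram matrix would be the coefficient vector of a coordinate vector of
length zero, against the injectivity of the differential of the inverse chart. -/
theorem det_chartGram_ne_zero [RiemannianBundle (fun x : M => TangentSpace (𝓡 n) x)]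
    (p : M) {y : EuclideanSpace ℝ (Fin n)}
    (hy : y ∈ (chartAt (EuclideanSpace ℝ (Fin n)) p).target) :
    (chartGram (n := n) p y).det ≠ 0 := by
  intro h
  obtain ⟨a, ha, h0⟩ := Matrix.exists_mulVec_eq_zero_iff.2 h
  have h1 := inner_chartVector p (WithLp.toLp 2 a) (WithLp.toLp 2 a) y
  rw [h0] at h1
  have h2 : chartVector p (WithLp.toLp 2 a) y = 0 := by
    rw [← inner_self_eq_zero (𝕜 := ℝ), h1]; simp
  have h3 : WithLp.toLp 2 a = 0 := chartVector_injective p hy (by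
    simp only [h2]; exact (map_zero _).symm)
  exact ha (by simpa using h3)

end Chart

/-! ### Classical gradients -/

section Gradient

variable {n : ℕ} {M : Type*} [TopologicalSpace M]
  [ChartedSpace (EuclideanSpace ℝ (Fin n)) M]
  [RiemannianBundle (fun x : M => TangentSpace (𝓡 n) x)]

/-- The vector field `X` is the gradient of the differentiable function `f` at the points of `S`. -/
def IsGradientOn (S : Set M) (f : M → ℝ) (X : ∀ x : M, TangentSpace (𝓡 n) x) : Prop :=
  ∀ x ∈ S, ∀ v : TangentSpace (𝓡 n) x, mfderiv (𝓡 n) 𝓘(ℝ, ℝ) f x v = ⟪X x, v⟫_ℝ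

/-- Every function has a gradient, by the Riesz representation theorem. -/
theorem exists_isGradientOn (f : M → ℝ) :
    ∃ X : ∀ x : M, TangentSpace (𝓡 n) x, IsGradientOn univ f X := by
  have h : ∀ x : M, ∃ X : TangentSpace (𝓡 n) x, ∀ v : TangentSpace (𝓡 n) x,
      mfderiv (𝓡 n) 𝓘(ℝ, ℝ) f x v = ⟪X, v⟫_ℝ := fun x => by
    have hfd : FiniteDimensional ℝ (TangentSpace (𝓡 n) x) :=
      inferInstanceAs (FiniteDimensional ℝ (EuclideanSpace ℝ (Fin n)))
    have hc : CompleteSpace (TangentSpace (𝓡 n) x) := FiniteDimensional.complete ℝ _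
    -- Where `f` is not differentiable, `mfderiv` is zero and Riesz representation still applies.
    -- `L` is the bare linear map; its continuity for the metric norm is recovered from finite
    -- dimension.
    let L : TangentSpace (𝓡 n) x →ₗ[ℝ] ℝ := (mfderiv (𝓡 n) 𝓘(ℝ, ℝ) f x).toLinearMap
    refine ⟨(InnerProductSpace.toDual ℝ (TangentSpace (𝓡 n) x)).symm
      (LinearMap.toContinuousLinearMap L), fun v => ?_⟩
    rw [InnerProductSpace.toDual_symm_apply]
    rfl
  choose X hX using h
  exact ⟨X, fun x _ => hX x⟩

/-- The chain rule for `f` after the inverse chart; it moves questions about the gradient into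
Euclidean space. -/
theorem IsGradientOn.fderiv_comp_chart_symm [IsManifold (𝓡 n) ∞ M] {D : TopologicalSpace.Opens M}
    {f : M → ℝ} {X : ∀ x : M, TangentSpace (𝓡 n) x} (hX : IsGradientOn (D : Set M) f X)
    (hf : ContMDiffOn (𝓡 n) 𝓘(ℝ, ℝ) ∞ f D) (p : M) {y : EuclideanSpace ℝ (Fin n)}
    (hy : y ∈ chartDomain (n := n) D p) (v : EuclideanSpace ℝ (Fin n)) :
    fderiv ℝ (fun y => f ((chartAt (EuclideanSpace ℝ (Fin n)) p).symm y)) y v =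
      ⟪X ((chartAt (EuclideanSpace ℝ (Fin n)) p).symm y), chartVector p v y⟫_ℝ := by
  have : IsManifold (𝓡 n) 1 M := IsManifold.of_le (n := ∞) (by simp)
  rw [← hX _ hy.2, chartVector, ← mfderiv_eq_fderiv]
  have h1 : MDifferentiableAt (𝓡 n) 𝓘(ℝ, ℝ) f ((chartAt (EuclideanSpace ℝ (Fin n)) p).symm y) :=
    (hf.contMDiffAt (D.isOpen.mem_nhds hy.2)).mdifferentiableAt (by simp)
  have h2 : MDifferentiableAt (𝓡 n) (𝓡 n) (chartAt (EuclideanSpace ℝ (Fin n)) p).symm y :=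
    (mdifferentiable_chart (I := 𝓡 n) p).mdifferentiableAt_symm hy.1
  exact congrArg (fun L => L v) (mfderiv_comp y h1 h2)

/-- Integration by parts in each chart: the test function has compact support in the chart domain,
so there is no boundary term. -/
theorem IsGradientOn.isWeakGradient [IsManifold (𝓡 n) ∞ M] {D : TopologicalSpace.Opens M}
    {f : M → ℝ} {X : ∀ x : M, TangentSpace (𝓡 n) x} (hX : IsGradientOn (D : Set M) f X)
    (hf : ContMDiffOn (𝓡 n) 𝓘(ℝ, ℝ) ∞ f D) : IsWeakGradient D f X := by
  intro p
  have hU := isOpen_chartDomain (n := n) D p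
  have hc := contDiffOn_comp_chart_symm hf p
  have hloc := hc.continuousOn.locallyIntegrableOn (μ := volume) hU.measurableSet
  refine ⟨hloc, fun v => ?_⟩
  have hcd : ContinuousOn (fun y => fderiv ℝ
      (fun y => f ((chartAt (EuclideanSpace ℝ (Fin n)) p).symm y)) y v)
      (chartDomain (n := n) D p) :=
    (hc.continuousOn_fderiv_of_isOpen hU (by simp)).clm_apply continuousOn_const
  have hloc' : LocallyIntegrableOn (fun y => fderiv ℝ
      (fun y => f ((chartAt (EuclideanSpace ℝ (Fin n)) p).symm y)) y v)
      (chartDomain (n := n) D p) := hcd.locallyIntegrableOn hU.measurableSet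
  refine ⟨(hcd.congr fun y hy => (hX.fderiv_comp_chart_symm hf p hy v).symm).locallyIntegrableOn
    hU.measurableSet, fun ψ h1 h2 h3 => ?_⟩
  have hd : Continuous fun y => fderiv ℝ ψ y v :=
    (h1.continuous_fderiv (by simp)).clm_apply continuous_const
  rw [integral_mul_fderiv_eq_neg_fderiv_mul_of_integrable
    (integrable_mul_test hloc' h1.continuous h2 h3)
    (integrable_mul_test hloc hd (h2.fderiv_apply ℝ v) ((tsupport_fderiv_apply_subset ℝ v).trans h3))
    (integrable_mul_test hloc h1.continuous h2 h3)
    (fun y hy => (hc.contDiffAt (hU.mem_nhds (h3 hy))).differentiableAt (by simp))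
    (fun y _ => h1.differentiable (by simp) y)]
  congr 1
  refine integral_congr_ae (Eventually.of_forall fun y => ?_)
  -- The chain rule is available only inside the chart domain; off the support of `ψ` both
  -- integrands vanish.
  by_cases hy : y ∈ tsupport ψ
  · simp only
    rw [hX.fderiv_comp_chart_symm hf p (h3 hy) v]
  · simp [image_eq_zero_of_notMem_tsupport hy]

/-- A smooth function of a smooth function has the gradient given by the chain rule. -/
theorem IsGradientOn.comp_left {D : TopologicalSpace.Opens M} {f g : M → ℝ}
    {X : ∀ x : M, TangentSpace (𝓡 n) x} (hX : IsGradientOn (D : Set M) f X)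
    (hf : ContMDiffOn (𝓡 n) 𝓘(ℝ, ℝ) ∞ f D) {θ : ℝ → ℝ} (hθ : Differentiable ℝ θ)
    (hg : ∀ x ∈ D, g x = θ (f x)) :
    IsGradientOn (D : Set M) g (fun x => deriv θ (f x) • X x) := by
  intro x hx v
  have h1 : MDifferentiableAt (𝓡 n) 𝓘(ℝ, ℝ) f x :=
    (hf.contMDiffAt (D.isOpen.mem_nhds hx)).mdifferentiableAt (by simp)
  have h2 : HasMFDerivAt 𝓘(ℝ, ℝ) 𝓘(ℝ, ℝ) θ (f x) (fderiv ℝ θ (f x)) :=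
    (hθ (f x)).hasFDerivAt.hasMFDerivAt
  have h3 : g =ᶠ[𝓝 x] θ ∘ f := by
    filter_upwards [D.isOpen.mem_nhds hx] with z hz using hg z hz
  rw [h3.mfderiv_eq, (h2.comp x h1.hasMFDerivAt).mfderiv, real_inner_smul_left, ← hX x hx v]
  change fderiv ℝ θ (f x) (mfderiv (𝓡 n) 𝓘(ℝ, ℝ) f x v) = _
  exact (fderiv_eq_smul_deriv (f := θ) (x := f x) _).trans (mul_comm _ _)

variable [IsManifold (𝓡 n) ∞ M]
  [IsContMDiffRiemannianBundle (𝓡 n) ∞ (EuclideanSpace ℝ (Fin n))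
    (fun x : M => TangentSpace (𝓡 n) x)]

/-- The gradient of a smooth function is continuous. -/
theorem IsGradientOn.continuousOn {D : TopologicalSpace.Opens M} {f : M → ℝ}
    {X : ∀ x : M, TangentSpace (𝓡 n) x} (hX : IsGradientOn (D : Set M) f X)
    (hf : ContMDiffOn (𝓡 n) 𝓘(ℝ, ℝ) ∞ f D) :
    ContinuousOn (fun x => (⟨x, X x⟩ : TangentBundle (𝓡 n) M)) D := by
  intro x hx
  let e := chartAt (EuclideanSpace ℝ (Fin n)) x
  have hU := isOpen_chartDomain (n := n) D x
  let d : EuclideanSpace ℝ (Fin n) → Fin n → ℝ := fun y i =>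
    fderiv ℝ (fun y => f (e.symm y)) y (EuclideanSpace.single i 1)
  -- The coordinates `g^{ij} ∂_j f` of the gradient. Their continuity follows from that of the
  -- metric and of the partial derivatives of `f`.
  let w : EuclideanSpace ℝ (Fin n) → EuclideanSpace ℝ (Fin n) := fun y =>
    WithLp.toLp 2 ((chartGram x y)⁻¹.mulVec (d y))
  have hd : ContinuousOn d (chartDomain (n := n) D x) := continuousOn_pi.2 fun i =>
    ((contDiffOn_comp_chart_symm hf x).continuousOn_fderiv_of_isOpen hU
      (by simp)).clm_apply continuousOn_const
  have hG := (continuousOn_chartGram (n := n) x).mono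
    (inter_subset_left : chartDomain (n := n) D x ⊆ _)
  have hGi : ContinuousOn (fun y => (chartGram (n := n) x y)⁻¹) (chartDomain (n := n) D x) := by
    -- The inverse matrix is the adjugate divided by the determinant, both continuous in the
    -- entries.
    simp only [Matrix.inv_def, Ring.inverse_eq_inv']
    exact ContinuousOn.smul (((Continuous.matrix_det continuous_id).comp_continuousOn hG).inv₀
      fun y hy => det_chartGram_ne_zero x hy.1)
      ((Continuous.matrix_adjugate continuous_id).comp_continuousOn hG)
  have hw : ContinuousOn w (chartDomain (n := n) D x) :=
    (PiLp.continuous_toLp 2 _).comp_continuousOn ((Continuous.matrix_mulVec continuous_fst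
      continuous_snd).comp_continuousOn (hGi.prodMk hd))
  have hXw : ∀ y ∈ chartDomain (n := n) D x, X (e.symm y) = chartVector x (w y) y := by
    intro y hy
    refine ext_inner_right ℝ fun v => ?_
    obtain ⟨b, rfl⟩ := chartVector_surjective x hy.1 v
    have hb : b = ∑ i, b i • EuclideanSpace.single i (1 : ℝ) := by
      ext j; simp [Finset.sum_apply, Pi.single_apply]
    have hdet : IsUnit (chartGram (n := n) x y).det :=
      isUnit_iff_ne_zero.2 (det_chartGram_ne_zero x hy.1)
    rw [← hX.fderiv_comp_chart_symm hf x hy b, inner_chartVector]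
    simp only [w, Matrix.mulVec_mulVec, Matrix.mul_nonsing_inv _ hdet, Matrix.one_mulVec]
    conv_lhs => rw [hb]
    simp [d, map_sum]; rfl
  have h1 : ContinuousOn (fun y => (⟨e.symm y, X (e.symm y)⟩ : TangentBundle (𝓡 n) M))
      (chartDomain (n := n) D x) :=
    (continuousOn_chartVector_comp x hw inter_subset_left).congr fun y hy => by
      simp only [hXw y hy]; rfl
  have hxU : e x ∈ chartDomain (n := n) D x :=
    ⟨mem_chart_target _ x, by
      change e.symm (e x) ∈ D
      rw [e.left_inv (mem_chart_source _ x)]; exact hx⟩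
  have h2 : ContinuousAt (fun z => (⟨e.symm (e z), X (e.symm (e z))⟩ : TangentBundle (𝓡 n) M)) x :=
    ContinuousAt.comp (f := e) (x := x) (h1.continuousAt (hU.mem_nhds hxU))
      (e.continuousAt (mem_chart_source _ x))
  refine (h2.congr ?_).continuousWithinAt
  filter_upwards [e.open_source.mem_nhds (mem_chart_source _ x)] with z hz
  rw [e.left_inv hz]

/-- Extended by zero, such a function is smooth on all of `M`: a point is either in the support,
hence in `D`, or has a neighbourhood where the function is zero. Its gradient is therefore
continuous on `M`, in particular up to `∂D`. -/
theorem classFc_subset_classF1 (D : TopologicalSpace.Opens M) : classFc n D ⊆ classF1 n D := by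
  rintro f ⟨hf, hs⟩
  have hsm : ContMDiff (𝓡 n) 𝓘(ℝ, ℝ) ∞ f := fun x => by
    by_cases hx : x ∈ tsupport f
    · exact hf.contMDiffAt (D.isOpen.mem_nhds (hs hx))
    · exact contMDiffAt_const.congr_of_eventuallyEq (notMem_tsupport_iff_eventuallyEq.1 hx)
  refine ⟨⟨hf, hsm.continuous.continuousOn, fun x hx => ?_⟩, ?_⟩
  · refine image_eq_zero_of_notMem_tsupport fun h => ?_
    rw [D.isOpen.frontier_eq] at hx
    exact hx.2 (hs h)
  · obtain ⟨X, hX⟩ := exists_isGradientOn (n := n) f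
    refine ⟨X, ContinuousOn.mono (IsGradientOn.continuousOn (D := ⊤) (fun x _ => hX x trivial)
      hsm.contMDiffOn) (subset_univ _), fun x _ => hX x trivial⟩

end Gradient

/-! ### Analytic tools: dominated convergence, truncation, derivatives on zero sets -/

/-- Dominated convergence in `L²`, for functions that are eventually zero at almost every point. -/
theorem tendsto_eLpNorm_two_zero_of_dominated {α : Type*} [MeasurableSpace α] {μ : Measure α}
    {h : ℕ → α → ℝ} {G : α → ℝ} (hm : ∀ k, AEStronglyMeasurable (h k) μ) (hG : MemLp G 2 μ)
    (hb : ∀ k, ∀ᵐ x ∂μ, ‖h k x‖ ≤ ‖G x‖) (hl : ∀ᵐ x ∂μ, Tendsto (fun k => h k x) atTop (𝓝 0)) :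
    Tendsto (fun k => eLpNorm (h k) 2 μ) atTop (𝓝 0) := by
  simp only [eLpNorm_eq_lintegral_rpow_enorm_toReal (p := 2) two_ne_zero ENNReal.ofNat_ne_top]
  have hlim : Tendsto (fun k => ∫⁻ x, ‖h k x‖ₑ ^ (2 : ℝ≥0∞).toReal ∂μ) atTop
      (𝓝 (∫⁻ _, 0 ∂μ)) := by
    refine tendsto_lintegral_of_dominated_convergence' (fun x => ‖G x‖ₑ ^ (2 : ℝ≥0∞).toReal)
      (fun k => (hm k).enorm.pow_const _) (fun k => ?_) ?_ ?_
    · filter_upwards [hb k] with x hx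
      exact ENNReal.rpow_le_rpow (enorm_le_iff_norm_le.2 hx) ENNReal.toReal_nonneg
    · exact (lintegral_rpow_enorm_lt_top_of_eLpNorm_lt_top two_ne_zero ENNReal.ofNat_ne_top
        hG.2).ne
    · filter_upwards [hl] with x hx
      have h1 : Tendsto (fun k => ‖h k x‖ₑ) atTop (𝓝 0) := by
        simpa [Function.comp_def] using (continuous_enorm.tendsto (0 : ℝ)).comp hx
      simpa [Function.comp_def] using ((ENNReal.continuous_rpow_const (y := (2 : ℝ≥0∞).toReal)).tendsto 0).comp h1
  rw [lintegral_zero] at hlim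
  simpa [Function.comp_def] using ((ENNReal.continuous_rpow_const (y := 1 / (2 : ℝ≥0∞).toReal)).tendsto 0).comp hlim

/-- Smooth functions with uniformly bounded derivatives, which are the identity near zero and
which converge to zero, with their derivatives, at every other point. -/
theorem exists_truncation : ∃ (θ : ℕ → ℝ → ℝ) (C : ℝ), (∀ k, ContDiff ℝ ∞ (θ k)) ∧
    (∀ k t, |θ k t| ≤ |t|) ∧ (∀ k t, |deriv (θ k) t| ≤ C) ∧
    (∀ k, ∃ ε > 0, ∀ t, |t| < ε → θ k t = t) ∧
    ∀ t, t ≠ 0 → ∀ᶠ k in atTop, θ k t = 0 ∧ deriv (θ k) t = 0 := by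
  let χ : ContDiffBump (0 : ℝ) := ⟨1, 2, one_pos, one_lt_two⟩
  -- `η` is the identity on `[-1, 1]` and zero off `[-2, 2]`. The truncations are `θ_k t =
  -- η((k+1)t)/(k+1)`: rescaling shrinks the support but only reparametrizes the derivative, so a
  -- bound `C` for `η'` serves all `k`. The shift to `k + 1` avoids dividing by zero.
  let η : ℝ → ℝ := fun s => s * χ s
  have hη : ContDiff ℝ ∞ η := contDiff_id.mul χ.contDiff
  have hηc : HasCompactSupport η := χ.hasCompactSupport.mul_left
  obtain ⟨C, hC⟩ := hηc.deriv.exists_bound_of_continuous (hη.continuous_deriv (by simp))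
  have hη0 : ∀ s : ℝ, 2 < |s| → η s = 0 ∧ deriv η s = 0 := by
    intro s hs
    have h1 : η =ᶠ[𝓝 s] fun _ => 0 := by
      filter_upwards [(isOpen_lt continuous_const continuous_abs).mem_nhds hs] with t ht
      simp only [η]
      rw [χ.zero_of_le_dist (by simpa using le_of_lt ht), mul_zero]
    exact ⟨h1.eq_of_nhds, by rw [h1.deriv_eq]; simp⟩
  have hc : ∀ k : ℕ, (0 : ℝ) < k + 1 := fun k => by positivity
  have hd : ∀ (k : ℕ) (t : ℝ), deriv (fun t => ((k : ℝ) + 1)⁻¹ * η ((k + 1) * t)) t =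
      deriv η ((k + 1) * t) := by
    intro k t
    have h1 : HasDerivAt (fun t : ℝ => ((k : ℝ) + 1) * t) ((k + 1) * 1) t :=
      (hasDerivAt_id t).const_mul _
    have h2 := ((hη.differentiable (by simp) (((k : ℝ) + 1) * t)).hasDerivAt.comp t h1).const_mul
      ((k : ℝ) + 1)⁻¹
    refine h2.deriv.trans ?_
    have := (hc k).ne'
    field_simp
  refine ⟨fun k t => ((k : ℝ) + 1)⁻¹ * η ((k + 1) * t), C, fun k => ?_, fun k t => ?_,
    fun k t => ?_, fun k => ⟨((k : ℝ) + 1)⁻¹, inv_pos.2 (hc k), fun t ht => ?_⟩, fun t ht => ?_⟩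
  · exact contDiff_const.mul (hη.comp (contDiff_const.mul contDiff_id))
  · have h1 : ((k : ℝ) + 1)⁻¹ * η ((k + 1) * t) = t * χ ((k + 1) * t) := by
      have := (hc k).ne'
      simp only [η]; field_simp
    simp only
    rw [h1, abs_mul, abs_of_nonneg χ.nonneg]
    exact mul_le_of_le_one_right (abs_nonneg _) χ.le_one
  · rw [hd]; exact hC _
  · have h1 : χ (((k : ℝ) + 1) * t) = 1 := by
      refine χ.one_of_mem_closedBall ?_
      have h2 : ((k : ℝ) + 1) * |t| ≤ 1 := by
        have := mul_le_mul_of_nonneg_left ht.le (hc k).le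
        rwa [mul_inv_cancel₀ (hc k).ne'] at this
      simpa [χ, abs_mul, abs_of_pos (hc k)] using h2
    have := (hc k).ne'
    simp only [η, h1]; field_simp
  · obtain ⟨N, hN⟩ := exists_nat_gt (2 / |t|)
    filter_upwards [eventually_ge_atTop N] with k hk
    have h1 : 2 < |((k : ℝ) + 1) * t| := by
      rw [abs_mul, abs_of_pos (hc k)]
      refine (div_lt_iff₀ (abs_pos.2 ht)).1 (hN.trans ?_)
      have : (N : ℝ) ≤ k := by exact_mod_cast hk
      linarith
    exact ⟨by simp only [(hη0 _ h1).1, mul_zero], by rw [hd]; exact (hη0 _ h1).2⟩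

/-- The derivative of a function vanishes almost everywhere on its zero set. -/
theorem ae_fderiv_eq_zero_of_eq_zero {E : Type*} [NormedAddCommGroup E] [NormedSpace ℝ E]
    [FiniteDimensional ℝ E] [Nontrivial E] [MeasurableSpace E] [BorelSpace E] (μ : Measure E)
    [μ.IsAddHaarMeasure] {U : Set E} (hU : IsOpen U) {F : E → ℝ} (hF : DifferentiableOn ℝ F U) :
    ∀ᵐ y ∂(μ.restrict U), F y = 0 → fderiv ℝ F y = 0 := by
  -- `ApproximatesLinearOn.norm_fderiv_sub_le` concerns maps from `E` to itself, so `F` is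
  -- multiplied by a fixed nonzero vector.
  obtain ⟨w, hw⟩ := exists_ne (0 : E)
  have hs : MeasurableSet (U ∩ F ⁻¹' {0}) := by
    have h1 : U ∩ F ⁻¹' {0} = U \ (U ∩ F ⁻¹' {0}ᶜ) := by ext; simp
    rw [h1]
    exact hU.measurableSet.diff
      (hF.continuousOn.isOpen_inter_preimage hU isOpen_compl_singleton).measurableSet
  -- On the zero set `F • w` coincides with the zero map, so it is approximated with constant `0`.
  -- At almost every point of that set, the derivative is then within distance `0` of the zero map.
  have happ : ApproximatesLinearOn (fun y => F y • w) (0 : E →L[ℝ] E) (U ∩ F ⁻¹' {0}) 0 := by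
    intro x hx y hy
    have hx' : F x = 0 := hx.2
    have hy' : F y = 0 := hy.2
    simp [hx', hy']
  have h := happ.norm_fderiv_sub_le μ hs (fun y => (fderiv ℝ F y).smulRight w) fun y hy =>
    ((hF.differentiableAt (hU.mem_nhds hy.1)).hasFDerivAt.smul_const w).hasFDerivWithinAt
  rw [ae_restrict_iff' hs] at h
  rw [ae_restrict_iff' hU.measurableSet]
  filter_upwards [h] with y hy hyU hy0
  have h2 := hy ⟨hyU, hy0⟩
  simpa [hw] using h2

/-! ### Almost everywhere properties of gradients -/

section WeakGradients

variable {n : ℕ} {M : Type*} [TopologicalSpace M] [SecondCountableTopology M]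
  [MeasurableSpace M] [BorelSpace M]
  [ChartedSpace (EuclideanSpace ℝ (Fin n)) M] [IsManifold (𝓡 n) ∞ M]
  [RiemannianBundle (fun x : M => TangentSpace (𝓡 n) x)]

/-- Weak gradients are unique up to a null set. -/
theorem IsWeakGradient.ae_eq {D : TopologicalSpace.Opens M} {f : M → ℝ}
    {X Y : ∀ x : M, TangentSpace (𝓡 n) x} (hX : IsWeakGradient D f X)
    (hY : IsWeakGradient D f Y) :
    ∀ᵐ x ∂((riemannianVolume n M).restrict D), X x = Y x := by
  refine ae_restrict_riemannianVolume fun p => ?_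
  have hU := isOpen_chartDomain (n := n) D p
  -- The fundamental lemma of the calculus of variations, one basis direction at a time: with
  -- finitely many directions the exceptional sets have a null union.
  have h : ∀ i : Fin n, ∀ᵐ y ∂(volume : Measure (EuclideanSpace ℝ (Fin n))),
      y ∈ chartDomain (n := n) D p →
      ⟪X ((chartAt (EuclideanSpace ℝ (Fin n)) p).symm y),
        chartVector p (EuclideanSpace.single i 1) y⟫_ℝ -
      ⟪Y ((chartAt (EuclideanSpace ℝ (Fin n)) p).symm y),
        chartVector p (EuclideanSpace.single i 1) y⟫_ℝ = 0 := by
    intro i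
    obtain ⟨hX1, hX2⟩ := (hX p).2 (EuclideanSpace.single i 1)
    obtain ⟨hY1, hY2⟩ := (hY p).2 (EuclideanSpace.single i 1)
    refine hU.ae_eq_zero_of_integral_contDiff_smul_eq_zero (hX1.sub hY1) fun g h1 h2 h3 => ?_
    simp only [smul_eq_mul, mul_comm (g _), sub_mul]
    rw [integral_sub (integrable_mul_test hX1 h1.continuous h2 h3)
      (integrable_mul_test hY1 h1.continuous h2 h3), sub_eq_zero, ← neg_inj,
      ← hX2 g h1 h2 h3, ← hY2 g h1 h2 h3]
  rw [ae_restrict_iff' hU.measurableSet]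
  filter_upwards [ae_all_iff.2 h] with y hy hyU
  refine ext_inner_right ℝ fun v => ?_
  obtain ⟨b, rfl⟩ := chartVector_surjective p hyU.1 v
  simp only
  rw [chartVector_eq_sum p b, inner_sum, inner_sum]
  refine Finset.sum_congr rfl fun i _ => ?_
  rw [real_inner_smul_right, real_inner_smul_right, sub_eq_zero.1 (hy i hyU)]

/-- The gradient of a smooth function vanishes almost everywhere on its zero set. -/
theorem IsGradientOn.ae_eq_zero [NeZero n] {D : TopologicalSpace.Opens M} {f : M → ℝ}
    {X : ∀ x : M, TangentSpace (𝓡 n) x} (hX : IsGradientOn (D : Set M) f X)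
    (hf : ContMDiffOn (𝓡 n) 𝓘(ℝ, ℝ) ∞ f D) :
    ∀ᵐ x ∂((riemannianVolume n M).restrict D), f x = 0 → X x = 0 := by
  refine ae_restrict_riemannianVolume fun p => ?_
  have hU := isOpen_chartDomain (n := n) D p
  filter_upwards [ae_fderiv_eq_zero_of_eq_zero volume hU
    ((contDiffOn_comp_chart_symm hf p).differentiableOn (by simp)),
    ae_restrict_mem hU.measurableSet] with y hy hyU h0
  refine ext_inner_right ℝ fun v => ?_
  obtain ⟨b, rfl⟩ := chartVector_surjective p hyU.1 v
  simp only
  rw [← hX.fderiv_comp_chart_symm hf p hyU, hy h0, inner_zero_left]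
  rfl

end WeakGradients

/-! ### Approximation by compactly supported functions -/

section Closures

variable {n : ℕ} {M : Type*} [TopologicalSpace M] [SecondCountableTopology M]
  [MeasurableSpace M] [BorelSpace M]
  [ChartedSpace (EuclideanSpace ℝ (Fin n)) M] [IsManifold (𝓡 n) ∞ M]
  [RiemannianBundle (fun x : M => TangentSpace (𝓡 n) x)]
  [IsContMDiffRiemannianBundle (𝓡 n) ∞ (EuclideanSpace ℝ (Fin n))
    (fun x : M => TangentSpace (𝓡 n) x)]

theorem isFiniteMeasure_restrict_riemannianVolume [T2Space M] {D : TopologicalSpace.Opens M}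
    (hD : IsCompact (closure (D : Set M))) :
    IsFiniteMeasure ((riemannianVolume n M).restrict D) :=
  ⟨by rw [Measure.restrict_apply_univ]
      exact (measure_mono subset_closure).trans_lt (riemannianVolume_lt_top hD)⟩

/-- The function and the norm of its gradient are continuous on the compact `D̄`, hence bounded, and
`D` has finite volume. -/
theorem memSobolev_of_mem_classF1 [T2Space M] {D : TopologicalSpace.Opens M}
    (hD : IsCompact (closure (D : Set M))) {f : M → ℝ} (hf : f ∈ classF1 n D) :
    MemSobolev n D f := by
  obtain ⟨⟨hsm, hc, -⟩, X, hXc, hX⟩ := hf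
  have := isContinuousRiemannianBundle_tangentSpace (n := n) (M := M)
  have := isFiniteMeasure_restrict_riemannianVolume (n := n) hD
  have hXn : ContinuousOn (fun x => ‖X x‖) (closure (D : Set M)) := by
    have h := (hXc.inner_bundle hXc).sqrt
    simpa only [real_inner_self_eq_norm_sq, Real.sqrt_sq (norm_nonneg _)] using h
  have key : ∀ g : M → ℝ, ContinuousOn g (closure (D : Set M)) →
      MemLp g 2 ((riemannianVolume n M).restrict D) := fun g hg => by
    obtain ⟨B, hB⟩ := hD.exists_bound_of_continuousOn hg
    refine MemLp.of_bound
      ((hg.mono subset_closure).aestronglyMeasurable D.isOpen.measurableSet) B ?_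
    filter_upwards [ae_restrict_mem D.isOpen.measurableSet] with x hx using hB x (subset_closure hx)
  exact ⟨key f hc, X, IsGradientOn.isWeakGradient hX hsm, key _ hXn⟩

/-- Functions in `F_0(D) ∩ W^{1,2}(D)` are approximated, in norm and in mean, by functions in
`F_c(D)`: one cuts off their small values. -/
theorem exists_tendsto_classFc [NeZero n] [T2Space M] {D : TopologicalSpace.Opens M}
    (hD : IsCompact (closure (D : Set M))) {f : M → ℝ} (hf : f ∈ classF0 n D)
    (hfS : MemSobolev n D f) :
    ∃ g : ℕ → M → ℝ, (∀ k, g k ∈ classFc n D) ∧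
      Tendsto (fun k => sobolevENorm n D (f - g k)) atTop (𝓝 0) ∧
      Tendsto (fun k => ∫ x in (D : Set M), g k x ∂(riemannianVolume n M)) atTop
        (𝓝 (∫ x in (D : Set M), f x ∂(riemannianVolume n M))) := by
  obtain ⟨hsm, hc, h0⟩ := hf
  obtain ⟨hfL, Y, hY, hYL⟩ := hfS
  obtain ⟨X, hX⟩ := exists_isGradientOn (n := n) f
  replace hX : IsGradientOn (D : Set M) f X := fun x _ => hX x trivial
  have := isFiniteMeasure_restrict_riemannianVolume (n := n) hD
  obtain ⟨θ, C, hθ, hθf, hθC, hθ1, hθ0⟩ := exists_truncation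
  have hθz : ∀ k, θ k 0 = 0 := fun k => by simpa using hθf k 0
  have hmD : ∀ᵐ x ∂((riemannianVolume n M).restrict D), x ∈ D :=
    ae_restrict_mem D.isOpen.measurableSet
  -- Membership in `W^{1,2}` provides some weak gradient `Y`; by uniqueness the classical gradient
  -- `X` inherits its square integrability.
  have hXL : MemLp (fun x => ‖X x‖) 2 ((riemannianVolume n M).restrict D) :=
    (memLp_congr_ae (((hX.isWeakGradient hsm).ae_eq hY).mono fun x hx => by simp only [hx])).2 hYL
  -- The values of `f` outside `D̄` are arbitrary, whereas `F_c(D)` refers to the support in `M`;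
  -- hence the extension by zero.
  let g : ℕ → M → ℝ := fun k => (D : Set M).indicator fun x => f x - θ k (f x)
  have hg : ∀ k, ∀ x ∈ D, g k x = f x - θ k (f x) := fun k x hx => indicator_of_mem hx _
  have hgsm : ∀ k, ContMDiffOn (𝓡 n) 𝓘(ℝ, ℝ) ∞ (g k) D := fun k =>
    ((contDiff_id.sub (hθ k)).contMDiff.comp_contMDiffOn hsm).congr fun x hx => hg k x hx
  have hfg : ∀ k, ∀ x ∈ D, (f - g k) x = θ k (f x) := fun k x hx => by
    rw [Pi.sub_apply, hg k x hx, sub_sub_cancel]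
  refine ⟨g, fun k => ⟨hgsm k, ?_⟩, ?_, ?_⟩
  · obtain ⟨ε, hε, hθε⟩ := hθ1 k
    -- `g k` is nonzero only where `ε ≤ |f|`. Within `D̄` this is a closed condition that fails on
    -- `∂D`, so the closed support stays in `D`.
    have hcl : IsClosed (closure (D : Set M) ∩ f ⁻¹' {t | ε ≤ |t|}) :=
      hc.preimage_isClosed_of_isClosed isClosed_closure
        (isClosed_le continuous_const continuous_abs)
    refine (closure_minimal (fun x hx => ?_) hcl).trans fun x hx => ?_
    · have hxD : x ∈ (D : Set M) := mem_of_indicator_ne_zero hx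
      refine ⟨subset_closure hxD, not_lt.1 fun hlt : |f x| < ε => hx ?_⟩
      rw [hg k x hxD, hθε _ hlt, sub_self]
    · by_contra hxD
      have h1 : f x = 0 := h0 x (by rw [D.isOpen.frontier_eq]; exact ⟨hx.1, hxD⟩)
      have h2 : ε ≤ |f x| := hx.2
      rw [h1, abs_zero] at h2
      exact absurd h2 (not_le.2 hε)
  · let h : ℕ → M → ℝ := fun k x => √ ((f - g k) x ^ 2 + ‖deriv (θ k) (f x) • X x‖ ^ 2)
    have hW : ∀ k, IsWeakGradient D (f - g k) (fun x => deriv (θ k) (f x) • X x) := fun k =>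
      (hX.comp_left hsm ((hθ k).differentiable (by simp)) (hfg k)).isWeakGradient
        (hsm.sub (hgsm k))
    have hle : ∀ k, sobolevENorm n D (f - g k) ≤
        eLpNorm (h k) 2 ((riemannianVolume n M).restrict D) := fun k => iInf₂_le _ (hW k)
    refine tendsto_of_tendsto_of_tendsto_of_le_of_le tendsto_const_nhds ?_ (fun _ => zero_le) hle
    refine tendsto_eLpNorm_two_zero_of_dominated (fun k => ?_)
      (hfL.norm.add (hXL.const_mul C)) (fun k => ?_) ?_
    · have h1 : AEMeasurable (f - g k) ((riemannianVolume n M).restrict D) :=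
        ((hsm.sub (hgsm k)).continuousOn.aemeasurable D.isOpen.measurableSet)
      exact ((h1.pow_const 2).add ((hW k).aemeasurable_norm.pow_const 2)).sqrt.aestronglyMeasurable
    · filter_upwards [hmD] with x hx
      have hC0 : 0 ≤ C := (abs_nonneg _).trans (hθC k 0)
      have hp : 0 ≤ ‖f x‖ + C * ‖X x‖ :=
        add_nonneg (norm_nonneg _) (mul_nonneg hC0 (norm_nonneg _))
      rw [Real.norm_of_nonneg (Real.sqrt_nonneg _), hfg k x hx, norm_smul]
      change _ ≤ ‖‖f x‖ + C * ‖X x‖‖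
      rw [Real.norm_of_nonneg hp, Real.sqrt_le_iff]
      refine ⟨hp, ?_⟩
      have h1 : (θ k (f x)) ^ 2 ≤ ‖f x‖ ^ 2 := sq_le_sq.2 (by simpa using hθf k (f x))
      have h2 : (‖deriv (θ k) (f x)‖ * ‖X x‖) ^ 2 ≤ (C * ‖X x‖) ^ 2 :=
        pow_le_pow_left₀ (by positivity)
          (mul_le_mul_of_nonneg_right (hθC k (f x)) (norm_nonneg _)) 2
      nlinarith [mul_nonneg (norm_nonneg (f x)) (mul_nonneg hC0 (norm_nonneg (X x)))]
    -- Where `f = 0` the truncation does not help, since `θ_k' = 1` at zero; there the gradient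
    -- itself vanishes almost everywhere.
    · filter_upwards [hmD, hX.ae_eq_zero hsm] with x hx hx0
      refine tendsto_const_nhds.congr' ?_
      by_cases hfx : f x = 0
      · refine Eventually.of_forall fun k => ?_
        simp only [h]
        rw [hfg k x hx, hfx, hθz k, hx0 hfx]
        simp
      · filter_upwards [hθ0 _ hfx] with k hk
        simp only [h]
        rw [hfg k x hx, hk.1, hk.2]
        simp
  -- The bound is integrable because square integrable functions are integrable on the finite volume
  -- of `D`.
  · refine tendsto_integral_of_dominated_convergence (fun x => 2 * ‖f x‖)
      (fun k => (hgsm k).continuousOn.aestronglyMeasurable D.isOpen.measurableSet)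
      ((hfL.integrable (by norm_num)).norm.const_mul 2) (fun k => ?_) ?_
    · filter_upwards [hmD] with x hx
      rw [hg k x hx, two_mul]
      exact (norm_sub_le _ _).trans (add_le_add_right (hθf k (f x)) _)
    · filter_upwards [hmD] with x hx
      refine tendsto_const_nhds.congr' ?_
      by_cases hfx : f x = 0
      · exact Eventually.of_forall fun k => by simp only [hg k x hx, hfx, hθz k, sub_zero]
      · filter_upwards [hθ0 _ hfx] with k hk
        rw [hg k x hx, hk.1, sub_zero]

/-- Functions in `G_0(D) ∩ W^{1,2}(D)` are approximated by functions in `G_c(D)`. -/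
theorem exists_tendsto_classGc [NeZero n] [T2Space M] {D : TopologicalSpace.Opens M}
    (hD : IsCompact (closure (D : Set M))) {f : M → ℝ} (hf : f ∈ classG0 n D)
    (hfS : MemSobolev n D f) :
    ∃ g : ℕ → M → ℝ, (∀ k, g k ∈ classGc n D) ∧
      Tendsto (fun k => sobolevENorm n D (f - g k)) atTop (𝓝 0) := by
  obtain ⟨g, hg, hlim, hint⟩ := exists_tendsto_classFc hD hf.1 hfS
  rw [hf.2] at hint
  -- If every function in `F_c(D)` has mean zero, the approximants need no correction.
  by_cases hall : ∀ h ∈ classFc n D, ∫ x in (D : Set M), h x ∂(riemannianVolume n M) = 0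
  · exact ⟨g, fun k => ⟨hg k, hall _ (hg k)⟩, hlim⟩
  push Not at hall
  obtain ⟨h, hh, hh0⟩ := hall
  have := isFiniteMeasure_restrict_riemannianVolume (n := n) hD
  have hS : ∀ k ∈ classFc n D, MemSobolev n D k := fun k hk =>
    memSobolev_of_mem_classF1 hD (classFc_subset_classF1 D hk)
  have hI : ∀ k ∈ classFc n D, IntegrableOn k D (riemannianVolume n M) := fun k hk =>
    (hS k hk).1.integrable (by norm_num)
  -- The coefficient for which `g k - c k • h` has mean zero. It tends to `0` because the integrals
  -- of the `g k` tend to that of `f`, which is `0`, so the correction disappears in norm.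
  let c : ℕ → ℝ := fun k => (∫ x in (D : Set M), g k x ∂(riemannianVolume n M)) /
    ∫ x in (D : Set M), h x ∂(riemannianVolume n M)
  have hc : Tendsto c atTop (𝓝 0) := by simpa using hint.div_const _
  refine ⟨fun k => g k - c k • h, fun k => ⟨⟨(hg k).1.sub
    ((contDiff_const_smul (c k)).contMDiff.comp_contMDiffOn hh.1), ?_⟩, ?_⟩, ?_⟩
  · refine (tsupport_sub _ _).trans (union_subset (hg k).2 ?_)
    exact (tsupport_smul_subset_right (fun _ => c k) h).trans hh.2
  · simp only [Pi.sub_apply, Pi.smul_apply, smul_eq_mul]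
    rw [integral_sub (hI _ (hg k)) ((hI _ hh).const_mul _), integral_const_mul,
      div_mul_cancel₀ _ hh0, sub_self]
  · have hle : ∀ k, sobolevENorm n D (f - (g k - c k • h)) ≤
        sobolevENorm n D (f - g k) + ‖c k‖ₑ * sobolevENorm n D h := fun k => by
      have h1 : f - (g k - c k • h) = (f - g k) + c k • h := by abel
      have h2 : MemSobolev n D (f - g k) := by
        have := hfS.add ((hS _ (hg k)).smul (-1))
        rwa [neg_one_smul, ← sub_eq_add_neg] at this
      rw [h1]
      exact (sobolevENorm_add_le h2 ((hS h hh).smul _)).trans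
        (add_le_add_right (sobolevENorm_smul_le _ _) _)
    refine tendsto_of_tendsto_of_tendsto_of_le_of_le tendsto_const_nhds ?_ (fun _ => zero_le) hle
    have h3 : Tendsto (fun k => ‖c k‖ₑ) atTop (𝓝 0) := by
      simpa [Function.comp_def] using (continuous_enorm.tendsto (0 : ℝ)).comp hc
    have h4 := ENNReal.Tendsto.mul_const (b := sobolevENorm n D h) h3
      (Or.inr (sobolevENorm_lt_top (hS h hh)).ne)
    simpa using hlim.add h4

/-- If functions in `S` are approximated by functions in `T`, the closure of `S` is contained in
that of `T`. -/
theorem closure_inSobolev_subset {D : TopologicalSpace.Opens M} {S T : Set (M → ℝ)}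
    (hT : ∀ g ∈ T, MemSobolev n D g)
    (h : ∀ f ∈ S, MemSobolev n D f → ∃ g : ℕ → M → ℝ, (∀ k, g k ∈ T) ∧
      Tendsto (fun k => sobolevENorm n D (f - g k)) atTop (𝓝 0)) :
    closure (inSobolev D S : Set (SobolevSpace n D)) ⊆ closure (inSobolev D T) := by
  refine closure_minimal ?_ isClosed_closure
  rintro _ ⟨f, hf, rfl⟩
  obtain ⟨g, hg, hlim⟩ := h f.1 hf f.2
  let G : ℕ → SobolevFun n D := fun k => ⟨g k, hT _ (hg k)⟩
  have hG : Tendsto G atTop (𝓝 f) := by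
    rw [tendsto_iff_norm_sub_tendsto_zero]
    have h1 : ∀ k, ‖G k - f‖ = (sobolevENorm n D (f.1 - g k)).toReal := fun k => by
      rw [norm_sub_rev]; rfl
    simp only [h1]
    simpa [Function.comp_def] using (ENNReal.tendsto_toReal ENNReal.zero_ne_top).comp hlim
  -- The convergence takes place in the seminormed space of functions and passes to the quotient by
  -- continuity of the projection.
  exact mem_closure_of_tendsto ((SeparationQuotient.continuous_mk.tendsto f).comp hG)
    (Eventually.of_forall fun k => ⟨G k, hg k, rfl⟩)

theorem closure_inSobolev_mono {D : TopologicalSpace.Opens M} {S T : Set (M → ℝ)} (h : S ⊆ T) :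
    closure (inSobolev D S : Set (SobolevSpace n D)) ⊆ closure (inSobolev D T) :=
  closure_mono (image_mono fun _ hf => h hf)

end Closures

/-! ### Relative compactness and the theorem -/

/-- A generalized Lipschitz domain is relatively compact. -/
theorem IsGeneralizedLipschitzDomain.isCompact_closure {n : ℕ} [NeZero n] {M : Type u}
    [TopologicalSpace M] [T2Space M] [ChartedSpace (EuclideanSpace ℝ (Fin n)) M]
    {D : TopologicalSpace.Opens M} (hD : IsGeneralizedLipschitzDomain.{u, v} n D) :
    IsCompact (closure (D : Set M)) := by
  obtain ⟨D', _, _, -, -, _, ρ, hρ, hρD, -⟩ := hD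
  refine (isCompact_range hρ.smooth.continuous).closure_of_subset ?_
  rw [← hρD]
  exact image_subset_range _ _

end ThreeClosure

end

theorem theoremZ (n : ℕ) [NeZero n] (M : Type u) [TopologicalSpace M] [T2Space M]
    [SecondCountableTopology M] [MeasurableSpace M] [BorelSpace M]
    [ChartedSpace (EuclideanSpace ℝ (Fin n)) M] [IsManifold (𝓡 n) ∞ M]
    [RiemannianBundle (fun x : M => TangentSpace (𝓡 n) x)]
    [IsContMDiffRiemannianBundle (𝓡 n) ∞ (EuclideanSpace ℝ (Fin n))
      (fun x : M => TangentSpace (𝓡 n) x)]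
    (D : TopologicalSpace.Opens M)
    (hD : ThreeClosure.IsGeneralizedLipschitzDomain.{u, v} n D)
    (hfr : frontier (closure (D : Set M)) = frontier (D : Set M)) :
    (∀ f ∈ ThreeClosure.classF1 n D, ThreeClosure.MemSobolev n D f) ∧
    (∀ f ∈ ThreeClosure.classFc n D, ThreeClosure.MemSobolev n D f) ∧
    closure (ThreeClosure.inSobolev D (ThreeClosure.classF0 n D)) = ThreeClosure.spaceE n D ∧
    closure (ThreeClosure.inSobolev D (ThreeClosure.classF1 n D)) = ThreeClosure.spaceE n D ∧
    closure (ThreeClosure.inSobolev D (ThreeClosure.classFc n D)) = ThreeClosure.spaceE n D ∧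
    ThreeClosure.spaceE n D = ThreeClosure.spaceW0 n D ∧
    ThreeClosure.spaceH n D = closure (ThreeClosure.inSobolev D (ThreeClosure.classGc n D)) := by
  have hc := hD.isCompact_closure
  have hF1 : ∀ f ∈ ThreeClosure.classF1 n D, ThreeClosure.MemSobolev n D f := fun f hf =>
    ThreeClosure.memSobolev_of_mem_classF1 hc hf
  have hc1 := ThreeClosure.classFc_subset_classF1 (n := n) D
  have hFc : ∀ f ∈ ThreeClosure.classFc n D, ThreeClosure.MemSobolev n D f := fun f hf =>
    hF1 f (hc1 hf)
  have h10 : ThreeClosure.classF1 n D ⊆ ThreeClosure.classF0 n D := fun f hf => hf.1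
  -- This inclusion closes the circle: the inclusions `F_c ⊆ F_1 ⊆ F_0` give the opposite ones
  -- between closures.
  have h0c : closure (ThreeClosure.inSobolev (n := n) D (ThreeClosure.classF0 n D)) ⊆
      closure (ThreeClosure.inSobolev D (ThreeClosure.classFc n D)) :=
    ThreeClosure.closure_inSobolev_subset hFc fun f hf hfS => by
      obtain ⟨g, hg, hlim, -⟩ := ThreeClosure.exists_tendsto_classFc hc hf hfS
      exact ⟨g, hg, hlim⟩
  have hce : closure (ThreeClosure.inSobolev D (ThreeClosure.classFc n D)) =
      ThreeClosure.spaceE n D :=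
    Subset.antisymm (ThreeClosure.closure_inSobolev_mono (hc1.trans h10)) h0c
  refine ⟨hF1, hFc, rfl, Subset.antisymm (ThreeClosure.closure_inSobolev_mono h10)
    (h0c.trans (ThreeClosure.closure_inSobolev_mono hc1)), hce, hce.symm, Subset.antisymm
    (ThreeClosure.closure_inSobolev_subset (fun g hg => hFc g hg.1) fun f hf hfS =>
      ThreeClosure.exists_tendsto_classGc hc hf hfS)
    (ThreeClosure.closure_inSobolev_mono fun f hf => ⟨h10 (hc1 hf.1), hf.2⟩)⟩
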